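/- Let $U\subseteq\mathbb R^n$ be open (the domain of a coordinate chart of an $n$-dimensional manifold), with coordinates $x$, and let $y$ be the induced fibre coordinates on $TU$. Let $\alpha=\sqrt{a_{ij}(x)y^iy^j}$ be a smooth Riemannian metric and $\beta=b_i(x)y^i$, $\gamma=\gamma_i(x)y^i$ smooth 1-forms on $U$ with $\|\beta\|_\alpha<b_0$, $\|\gamma\|_\alpha<g_0$ pointwise. Let $\Psi(s,\bar s)$ be a positive $C^\infty$ function on $(-b_0,b_0)\times(-g_0,g_0)$, and suppose that $$F=\alpha\,\Psi(s,\bar s),\qquad s=\frac{\beta}{\alpha},\quad \bar s=\frac{\gamma}{\alpha},$$ is a Finsler metric (an $(\alpha,\beta,\gamma)$-metric). For a Finsler metric with fundamental tensor $g_{ij}=\tfrac12(F^2)_{y^iy^j}$ the spray coefficients are $$G^i=\tfrac14 g^{il}\Big\{\frac{\partial g_{jl}}{\partial x^k}+\frac{\partial g_{lk}}{\partial x^j}-\frac{\partial g_{jk}}{\partial x^l}\Big\}y^jy^k ;$$ $G^i$ denotes those of $F$ and ${}^\alpha G^i$ those of $\alpha$. Indices are raised with $a^{ij}$, $|$ is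 the covariant derivative of the Levi-Civita connection of $\alpha$, $\alpha_i=\partial\alpha/\partial y^i$, $\alpha^i=a^{ij}\alpha_j$, subscripts $s,\bar s$ on $\Psi$ denote partial derivatives evaluated at $(s,\bar s)$, and $$b^2=a^{ij}b_ib_j,\quad g^2=a^{ij}\gamma_i\gamma_j,\quad \theta=a^{ij}b_i\gamma_j,$$ $${}^\beta r_{ij}=\tfrac12(b_{i|j}+b_{j|i}),\quad {}^\beta s_{ij}=\tfrac12(b_{i|j}-b_{j|i}),\quad {}^\gamma r_{ij}=\tfrac12(\gamma_{i|j}+\gamma_{j|i}),\quad {}^\gamma s_{ij}=\tfrac12(\gamma_{i|j}-\gamma_{j|i}),$$ $${}^\beta r_{00}={}^\beta r_{ij}y^iy^j,\quad {}^\beta s^i_0=a^{ij}\,{}^\beta s_{jk}y^k,\quad {}^\beta s_0=b^i\,{}^\beta s_{ij}y^j,\quad {}^\beta\bar s_0={}^\beta s^i_0\gamma_i,$$ $${}^\gamma r_{00}={}^\gamma r_{ij}y^iy^j,\quad {}^\gamma s^i_0=a^{ij}\,{}^\gamma s_{jk}y^k,\quad {}^\gamma s_0=\gamma^i\,{}^\gamma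 s_{ij}y^j,\quad {}^\gamma\bar s_0={}^\gamma s^i_0b_i,$$ $$\Pi=\Psi-s\Psi_s-\bar s\Psi_{\bar s},\qquad J=\frac{\Psi_{ss}\Psi_{\bar s\bar s}-\Psi_{s\bar s}^2}{\Pi},$$ $$\Gamma=\Pi+(b^2-s^2)\Psi_{ss}+(g^2-\bar s^2)\Psi_{\bar s\bar s}+2(\theta-s\bar s)\Psi_{s\bar s}+\big[(b^2-s^2)(g^2-\bar s^2)-(\theta-s\bar s)^2\big]J,$$ $$\rho_0=\Psi\Psi_{ss}+\Psi_s^2,\quad \bar\rho_0=\Psi\Psi_{\bar s\bar s}+\Psi_{\bar s}^2,\quad \rho_3=\Psi\Psi_{s\bar s}+\Psi_s\Psi_{\bar s},$$ $$\rho_1=\Psi\Psi_s-s\rho_0-\bar s\rho_3,\quad \bar\rho_1=\Psi\Psi_{\bar s}-\bar s\bar\rho_0-s\rho_3,$$ $$\pi_1=\Psi_{\bar s}\Psi_{s\bar s}-\Psi_s\Psi_{\bar s\bar s}+s\Psi J,\qquad \pi_2=\Psi_s\Psi_{s\bar s}-\Psi_{\bar s}\Psi_{ss}+\bar s\Psi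 J,$$ $$\mathcal R^\beta={}^\beta r_{00}-\frac{2\alpha}{\Pi}\big[\Psi_s\,{}^\beta s_0+\Psi_{\bar s}\,{}^\gamma\bar s_0\big],\qquad \mathcal R^\gamma={}^\gamma r_{00}-\frac{2\alpha}{\Pi}\big[\Psi_s\,{}^\beta\bar s_0+\Psi_{\bar s}\,{}^\gamma s_0\big],$$ $$\Gamma_1=\big[\Psi_{ss}+(g^2-\bar s^2)J\big]\mathcal R^\beta+\big[\Psi_{s\bar s}-(\theta-s\bar s)J\big]\mathcal R^\gamma,$$ $$\Gamma_2=\big[\Psi_{\bar s\bar s}+(b^2-s^2)J\big]\mathcal R^\gamma+\big[\Psi_{s\bar s}-(\theta-s\bar s)J\big]\mathcal R^\beta,$$ $$\Gamma_3=\big[\rho_1+\pi_2(\theta-s\bar s)-\pi_1(g^2-\bar s^2)\big]\mathcal R^\beta+\big[\bar\rho_1-\pi_2(b^2-s^2)+\pi_1(\theta-s\bar s)\big]\mathcal R^\gamma.$$ Let $x\in U$ and $y\neq0$; if $n\le 2$, assume in addition $\Pi\ne0$ at $(x,y)$. Then $\Pi\neq0$ and $\Gamma\ne0$ at $(x,y)$,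 and for every $i$ $$G^i={}^\alpha G^i+\frac{\alpha}{\Pi}\big[\Psi_s\,{}^\beta s^i_0+\Psi_{\bar s}\,{}^\gamma s^i_0\big]+\frac1{2\Gamma}\Big[\Gamma_1b^i+\Gamma_2\gamma^i+\frac1\Psi\Gamma_3\alpha^i\Big].$$ -/

import Mathlib

open scoped ContDiff Matrix

noncomputable section

namespace Finsler

/-- Points of a coordinate domain and fibre coordinates of tangent vectors. -/
abbrev Coord (n : ℕ) : Type := Fin n → ℝ

/-- The partial derivative `∂f/∂x^i` at `x`. -/
def pd {n : ℕ} (i : Fin n) (f : Coord n → ℝ) (x : Coord n) : ℝ :=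
  fderiv ℝ f x (Pi.single i 1)

/-- The fundamental tensor `g_ij(x,y) = ½ ∂²(F²)/∂y^i∂y^j`. -/
def fundamentalTensor {n : ℕ} (F : Coord n → Coord n → ℝ) (x y : Coord n) :
    Matrix (Fin n) (Fin n) ℝ :=
  Matrix.of fun i j => (1 / 2) * pd i (fun z => pd j (fun w => F x w ^ 2) z) y

/-- `F` is a Finsler metric over the open set `U`, in the standard coordinates of `TU`. -/
structure IsFinslerMetric {n : ℕ} (U : Set (Coord n)) (F : Coord n → Coord n → ℝ) : Prop where
  nonneg : ∀ x ∈ U, ∀ y, 0 ≤ F x y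
  smooth : ContDiffOn ℝ ∞ (fun p : Coord n × Coord n => F p.1 p.2) (U ×ˢ {0}ᶜ)
  homog : ∀ x ∈ U, ∀ y, ∀ r : ℝ, 0 < r → F x (r • y) = r * F x y
  posDef : ∀ x ∈ U, ∀ y, y ≠ 0 → (fundamentalTensor F x y).PosDef

/-- The spray coefficients
`G^i = ¼ g^{il} (∂g_jl/∂x^k + ∂g_lk/∂x^j - ∂g_jk/∂x^l) y^j y^k`. -/
def sprayCoeff {n : ℕ} (F : Coord n → Coord n → ℝ) (x y : Coord n) (i : Fin n) : ℝ :=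
  (1 / 4) * ∑ l, (fundamentalTensor F x y)⁻¹ i l *
    ∑ j, ∑ k, (pd k (fun z => fundamentalTensor F z y j l) x
      + pd j (fun z => fundamentalTensor F z y l k) x
      - pd l (fun z => fundamentalTensor F z y j k) x) * y j * y k

/-- `a = (a_ij)` is a smooth Riemannian metric on `U`. -/
structure IsRiemannianMetric {n : ℕ} (U : Set (Coord n))
    (a : Coord n → Matrix (Fin n) (Fin n) ℝ) : Prop where
  smooth : ∀ i j, ContDiffOn ℝ ∞ (fun x => a x i j) U
  posDef : ∀ x ∈ U, (a x).PosDef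

/-- Christoffel symbols `Γ^k_ij` of the Levi-Civita connection of `a`. -/
def christoffel {n : ℕ} (a : Coord n → Matrix (Fin n) (Fin n) ℝ) (x : Coord n)
    (k i j : Fin n) : ℝ :=
  (1 / 2) * ∑ l, (a x)⁻¹ k l *
    (pd i (fun z => a z j l) x + pd j (fun z => a z i l) x - pd l (fun z => a z i j) x)

/-- The covariant derivative `w_{i|j} = ∂w_i/∂x^j - Γ^k_ij w_k` of the 1-form `w`. -/
def covDeriv {n : ℕ} (a : Coord n → Matrix (Fin n) (Fin n) ℝ) (w : Coord n → Coord n)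
    (x : Coord n) (i j : Fin n) : ℝ :=
  pd j (fun z => w z i) x - ∑ k, christoffel a x k i j * w x k

/-- `r_ij = ½ (w_{i|j} + w_{j|i})`. -/
def symPart {n : ℕ} (a : Coord n → Matrix (Fin n) (Fin n) ℝ) (w : Coord n → Coord n)
    (x : Coord n) (i j : Fin n) : ℝ :=
  (1 / 2) * (covDeriv a w x i j + covDeriv a w x j i)

/-- `s_ij = ½ (w_{i|j} - w_{j|i})`. -/
def skewPart {n : ℕ} (a : Coord n → Matrix (Fin n) (Fin n) ℝ) (w : Coord n → Coord n)
    (x : Coord n) (i j : Fin n) : ℝ :=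
  (1 / 2) * (covDeriv a w x i j - covDeriv a w x j i)

/-- `r_00 = r_ij y^i y^j`. -/
def r00 {n : ℕ} (a : Coord n → Matrix (Fin n) (Fin n) ℝ) (w : Coord n → Coord n)
    (x y : Coord n) : ℝ :=
  ∑ i, ∑ j, symPart a w x i j * y i * y j

/-- `s_i0 = s_ij y^j`. -/
def sLow0 {n : ℕ} (a : Coord n → Matrix (Fin n) (Fin n) ℝ) (w : Coord n → Coord n)
    (x y : Coord n) (i : Fin n) : ℝ :=
  ∑ j, skewPart a w x i j * y j

/-- Raising an index with `a`: `v^i = a^{ij} v_j`. -/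
def raise {n : ℕ} (a : Coord n → Matrix (Fin n) (Fin n) ℝ) (x : Coord n) (v : Coord n)
    (i : Fin n) : ℝ :=
  ∑ j, (a x)⁻¹ i j * v j

/-- `s^i_0 = a^{ij} s_j0`. -/
def sUp0 {n : ℕ} (a : Coord n → Matrix (Fin n) (Fin n) ℝ) (w : Coord n → Coord n)
    (x y : Coord n) (i : Fin n) : ℝ :=
  raise a x (sLow0 a w x y) i

/-- `s_0 = s_j y^j`, where `s_j = w^i s_ij`. -/
def s0 {n : ℕ} (a : Coord n → Matrix (Fin n) (Fin n) ℝ) (w : Coord n → Coord n)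
    (x y : Coord n) : ℝ :=
  ∑ j, (∑ i, raise a x (w x) i * skewPart a w x i j) * y j

/-- The mixed quantity `s^i_0 v_i`, with `s` taken from the 1-form `w`. -/
def sMixed0 {n : ℕ} (a : Coord n → Matrix (Fin n) (Fin n) ℝ) (w v : Coord n → Coord n)
    (x y : Coord n) : ℝ :=
  ∑ i, sUp0 a w x y i * v x i

/-- The inner product `a^{ij} w_i v_j` of two 1-forms. -/
def formInner {n : ℕ} (a : Coord n → Matrix (Fin n) (Fin n) ℝ) (w v : Coord n → Coord n)
    (x : Coord n) : ℝ :=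
  ∑ i, ∑ j, (a x)⁻¹ i j * w x i * v x j

/-- The norm `‖w‖_α` of a 1-form at `x`. -/
def formNorm {n : ℕ} (a : Coord n → Matrix (Fin n) (Fin n) ℝ) (w : Coord n → Coord n)
    (x : Coord n) : ℝ :=
  Real.sqrt (formInner a w w x)

/-- `∂ψ/∂s` for a function `ψ(s, t)`. -/
def dS (ψ : ℝ → ℝ → ℝ) : ℝ → ℝ → ℝ := fun s t => deriv (fun u => ψ u t) s

/-- `∂ψ/∂t` for a function `ψ(s, t)`. -/
def dT (ψ : ℝ → ℝ → ℝ) : ℝ → ℝ → ℝ := fun s t => deriv (fun u => ψ s u) t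

/-- The data `a_ij(x)`, `b_i(x)`, `γ_i(x)` and `Ψ(s, s̄)` of an (α,β,γ)-metric in coordinates;
the conditions on them are in `ABGData.IsABGMetric`. -/
structure ABGData (n : ℕ) where
  a : Coord n → Matrix (Fin n) (Fin n) ℝ
  b : Coord n → Coord n
  c : Coord n → Coord n
  Ψ : ℝ → ℝ → ℝ

namespace ABGData

variable {n : ℕ} (D : ABGData n) (x y : Coord n)

/-- `α = √(a_ij y^i y^j)`. -/
def alpha : ℝ := Real.sqrt (∑ i, ∑ j, D.a x i j * y i * y j)

/-- `β = b_i y^i`. -/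
def beta : ℝ := ∑ i, D.b x i * y i

/-- `γ = γ_i y^i`. -/
def gamma : ℝ := ∑ i, D.c x i * y i

/-- `s = β/α`. -/
def s : ℝ := D.beta x y / D.alpha x y

/-- `s̄ = γ/α`. -/
def t : ℝ := D.gamma x y / D.alpha x y

/-- `F = α Ψ(s, s̄)`. -/
def F : ℝ := D.alpha x y * D.Ψ (D.s x y) (D.t x y)

/-- `F = α Ψ(β/α, γ/α)` is an (α,β,γ)-metric on `U`: `α` is Riemannian, `β`, `γ` are smooth
1-forms with `‖β‖_α < b₀`, `‖γ‖_α < g₀`, `Ψ` is positive and smooth on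
`(-b₀, b₀) × (-g₀, g₀)`, and `F` is a Finsler metric. -/
structure IsABGMetric (U : Set (Coord n)) (b₀ g₀ : ℝ) : Prop where
  riemannian : IsRiemannianMetric U D.a
  smooth_b : ∀ i, ContDiffOn ℝ ∞ (fun x => D.b x i) U
  smooth_c : ∀ i, ContDiffOn ℝ ∞ (fun x => D.c x i) U
  norm_b : ∀ x ∈ U, formNorm D.a D.b x < b₀
  norm_c : ∀ x ∈ U, formNorm D.a D.c x < g₀
  smooth_Ψ : ContDiffOn ℝ ∞ (fun p : ℝ × ℝ => D.Ψ p.1 p.2)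
    (Set.Ioo (-b₀) b₀ ×ˢ Set.Ioo (-g₀) g₀)
  pos_Ψ : ∀ s ∈ Set.Ioo (-b₀) b₀, ∀ t ∈ Set.Ioo (-g₀) g₀, 0 < D.Ψ s t
  finsler : IsFinslerMetric U D.F

/-! `Ψ` and its partial derivatives at `(s, s̄)`; the letter `t` stands for `s̄`. -/

def P : ℝ := D.Ψ (D.s x y) (D.t x y)

def Ps : ℝ := dS D.Ψ (D.s x y) (D.t x y)

def Pt : ℝ := dT D.Ψ (D.s x y) (D.t x y)

def Pss : ℝ := dS (dS D.Ψ) (D.s x y) (D.t x y)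

def Pst : ℝ := dT (dS D.Ψ) (D.s x y) (D.t x y)

def Ptt : ℝ := dT (dT D.Ψ) (D.s x y) (D.t x y)

/-- `b² = a^{ij} b_i b_j`. -/
def bSq : ℝ := formInner D.a D.b D.b x

/-- `g² = a^{ij} γ_i γ_j`. -/
def gSq : ℝ := formInner D.a D.c D.c x

/-- `θ = a^{ij} b_i γ_j`. -/
def theta : ℝ := formInner D.a D.b D.c x

/-- `Π = Ψ - s Ψ_s - s̄ Ψ_s̄`. -/
def PiFun : ℝ := D.P x y - D.s x y * D.Ps x y - D.t x y * D.Pt x y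

/-- `J = (Ψ_ss Ψ_s̄s̄ - Ψ_ss̄²) / Π`. -/
def J : ℝ := (D.Pss x y * D.Ptt x y - D.Pst x y * D.Pst x y) / D.PiFun x y

/-- `b² - s²`. -/
def bb : ℝ := D.bSq x - D.s x y ^ 2

/-- `g² - s̄²`. -/
def gg : ℝ := D.gSq x - D.t x y ^ 2

/-- `θ - s s̄`. -/
def bg : ℝ := D.theta x - D.s x y * D.t x y

/-- `Γ = Π + (b²-s²) Ψ_ss + (g²-s̄²) Ψ_s̄s̄ + 2 (θ-s s̄) Ψ_ss̄
  + [(b²-s²)(g²-s̄²) - (θ-s s̄)²] J`. -/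
def GammaFun : ℝ :=
  D.PiFun x y + D.bb x y * D.Pss x y + D.gg x y * D.Ptt x y + 2 * D.bg x y * D.Pst x y
    + (D.bb x y * D.gg x y - D.bg x y ^ 2) * D.J x y

def rho0 : ℝ := D.P x y * D.Pss x y + D.Ps x y * D.Ps x y

def rho0Bar : ℝ := D.P x y * D.Ptt x y + D.Pt x y * D.Pt x y

def rho3 : ℝ := D.P x y * D.Pst x y + D.Ps x y * D.Pt x y

def rho1 : ℝ := D.P x y * D.Ps x y - D.s x y * D.rho0 x y - D.t x y * D.rho3 x y

def rho1Bar : ℝ := D.P x y * D.Pt x y - D.t x y * D.rho0Bar x y - D.s x y * D.rho3 x y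

/-- `π₁ = Ψ_s̄ Ψ_ss̄ - Ψ_s Ψ_s̄s̄ + s Ψ J`. -/
def pi1 : ℝ :=
  D.Pt x y * D.Pst x y - D.Ps x y * D.Ptt x y + D.s x y * D.P x y * D.J x y

/-- `π₂ = Ψ_s Ψ_ss̄ - Ψ_s̄ Ψ_ss + s̄ Ψ J`. -/
def pi2 : ℝ :=
  D.Ps x y * D.Pst x y - D.Pt x y * D.Pss x y + D.t x y * D.P x y * D.J x y

/-- `R^β = ^βr_00 - (2α/Π) (Ψ_s ^βs_0 + Ψ_s̄ ^γs̄_0)`, where `^γs̄_0 = ^γs^i_0 b_i`. -/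
def Rb : ℝ :=
  r00 D.a D.b x y - 2 * D.alpha x y / D.PiFun x y *
    (D.Ps x y * s0 D.a D.b x y + D.Pt x y * sMixed0 D.a D.c D.b x y)

/-- `R^γ = ^γr_00 - (2α/Π) (Ψ_s ^βs̄_0 + Ψ_s̄ ^γs_0)`, where `^βs̄_0 = ^βs^i_0 γ_i`. -/
def Rc : ℝ :=
  r00 D.a D.c x y - 2 * D.alpha x y / D.PiFun x y *
    (D.Ps x y * sMixed0 D.a D.b D.c x y + D.Pt x y * s0 D.a D.c x y)

def Gamma1 : ℝ :=
  (D.Pss x y + D.gg x y * D.J x y) * D.Rb x y + (D.Pst x y - D.bg x y * D.J x y) * D.Rc x y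

def Gamma2 : ℝ :=
  (D.Ptt x y + D.bb x y * D.J x y) * D.Rc x y + (D.Pst x y - D.bg x y * D.J x y) * D.Rb x y

def Gamma3 : ℝ :=
  (D.rho1 x y + D.pi2 x y * D.bg x y - D.pi1 x y * D.gg x y) * D.Rb x y
    + (D.rho1Bar x y - D.pi2 x y * D.bb x y + D.pi1 x y * D.bg x y) * D.Rc x y

/-- `b^i = a^{ij} b_j`. -/
def bUp (i : Fin n) : ℝ := raise D.a x (D.b x) i

/-- `γ^i = a^{ij} γ_j`. -/
def cUp (i : Fin n) : ℝ := raise D.a x (D.c x) i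

/-- `α^i = a^{ij} α_j`, where `α_j = ∂α/∂y^j`. -/
def alphaUp (i : Fin n) : ℝ := raise D.a x (fun j => pd j (D.alpha x) y) i

end ABGData

end Finsler

end

/-!
Write `Q = α²`. Then `F² = Q Ψ(β/√Q, γ/√Q)²` depends on the point and the fibre coordinate only
through `Q`, `β`, `γ`, with

`d(F²) = Ψ Π dQ + 2 p dβ + 2 q dγ`,  `p = α Ψ Ψ_s`,  `q = α Ψ Ψ_s̄`,

and the differentials of `Ψ Π`, `p`, `q` are combinations of `dQ`, `dβ`, `dγ` whose coefficients are
`ρ₀`, `ρ̄₀`, `ρ₃`, `ρ₁`, `ρ̄₁` up to powers of `α`. The same formulas serve for derivatives in `x`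
and in `y`.

In the fibre direction they give `g_ij = Ψ Π a_ij +` a symmetric expression in the covectors
`b`, `γ`, `α_i` (`fundamentalTensor_apply`). In the base direction, Euler's identities
`g_ij y^j = ½ ∂(F²)/∂y^i` and `g_ij y^i y^j = F²` turn the spray coefficients into
`G = ¼ g⁻¹ (δ(∂_y F²) - ∂_x F²)`, where `δ = y^k ∂/∂x^k` (`sprayCoeff_eq_mulVec`). With `H` the
spray coefficients of `α` one has `δQ = 4 α α_i H^i`, `δβ = r_00 + 2 b_i H^i` and
`δb_l - ∂_l β = 2 s_l0`, likewise for `γ` (`r00_eq`, `sLow0_eq`). Hence `g (G - H)` is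
`p s_l0 + q s'_l0` plus a combination of `b`, `γ`, `α_l`. Applying `g` to the asserted value of `G`
gives the same covector: the terms along `b`, `γ`, `α_l` match by three polynomial identities
(`spray_coefficients_solve`), and `g` is invertible (`sprayCoeff_F_eq`).

If `n ≥ 3`, some `v ≠ 0` is annihilated by `β` and `γ`. Along `v` the strictly convex function `F²`
has derivative `2 Ψ Π a(y, v)`, which vanishes where `y` is orthogonal to `v` and hence
nowhere else; where it vanishes, the second derivative `2 Ψ Π a(v, v)` is positive. So `Π ≠ 0`
(`PiFun_ne_zero_of_annihilated`). Finally `Γ` is, up to the factor `Ψ⁴ Π`, the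
determinant of the map induced by `g` on the span of `b`, `γ`, `α_i` (`det_induced_map`), which
is injective (`GammaFun_ne_zero`).
-/

namespace Finsler

/-! ### Functions of two real variables -/

section TwoVariables

variable {ψ : ℝ → ℝ → ℝ} {O : Set (ℝ × ℝ)}

/-- Joint differentiability identifies the Fréchet derivative with the partial derivatives `dS`,
`dT`, which are defined separately by restriction to lines. -/
theorem hasFDerivAt_uncurried (hO : IsOpen O)
    (hψ : ContDiffOn ℝ ∞ (fun p : ℝ × ℝ => ψ p.1 p.2) O) {p : ℝ × ℝ} (hp : p ∈ O) :
    HasFDerivAt (fun p : ℝ × ℝ => ψ p.1 p.2)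
      (dS ψ p.1 p.2 • ContinuousLinearMap.fst ℝ ℝ ℝ + dT ψ p.1 p.2 • ContinuousLinearMap.snd ℝ ℝ ℝ)
      p := by
  have hd : DifferentiableAt ℝ (fun p : ℝ × ℝ => ψ p.1 p.2) p :=
    (hψ.contDiffAt (hO.mem_nhds hp)).differentiableAt (by simp)
  have h := hd.hasFDerivAt
  have h1 : dS ψ p.1 p.2 = fderiv ℝ (fun p : ℝ × ℝ => ψ p.1 p.2) p (1, 0) :=
    (h.comp_hasDerivAt_of_eq p.1 ((hasDerivAt_id p.1).prodMk (hasDerivAt_const p.1 p.2)) rfl).deriv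
  have h2 : dT ψ p.1 p.2 = fderiv ℝ (fun p : ℝ × ℝ => ψ p.1 p.2) p (0, 1) :=
    (h.comp_hasDerivAt_of_eq p.2 ((hasDerivAt_const p.2 p.1).prodMk (hasDerivAt_id p.2)) rfl).deriv
  refine h.congr_fderiv ?_
  rw [h1, h2]
  ext <;> simp

theorem dS_eq_fderiv (hO : IsOpen O)
    (hψ : ContDiffOn ℝ ∞ (fun p : ℝ × ℝ => ψ p.1 p.2) O) {p : ℝ × ℝ} (hp : p ∈ O) :
    dS ψ p.1 p.2 = fderiv ℝ (fun p : ℝ × ℝ => ψ p.1 p.2) p (1, 0) := by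
  simp [(hasFDerivAt_uncurried hO hψ hp).fderiv]

theorem dT_eq_fderiv (hO : IsOpen O)
    (hψ : ContDiffOn ℝ ∞ (fun p : ℝ × ℝ => ψ p.1 p.2) O) {p : ℝ × ℝ} (hp : p ∈ O) :
    dT ψ p.1 p.2 = fderiv ℝ (fun p : ℝ × ℝ => ψ p.1 p.2) p (0, 1) := by
  simp [(hasFDerivAt_uncurried hO hψ hp).fderiv]

theorem contDiffOn_dS (hO : IsOpen O)
    (hψ : ContDiffOn ℝ ∞ (fun p : ℝ × ℝ => ψ p.1 p.2) O) :
    ContDiffOn ℝ ∞ (fun p : ℝ × ℝ => dS ψ p.1 p.2) O :=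
  ((hψ.fderiv_of_isOpen hO (m := ∞) (by simp)).clm_apply contDiffOn_const).congr
    fun _ hp => dS_eq_fderiv hO hψ hp

theorem contDiffOn_dT (hO : IsOpen O)
    (hψ : ContDiffOn ℝ ∞ (fun p : ℝ × ℝ => ψ p.1 p.2) O) :
    ContDiffOn ℝ ∞ (fun p : ℝ × ℝ => dT ψ p.1 p.2) O :=
  ((hψ.fderiv_of_isOpen hO (m := ∞) (by simp)).clm_apply contDiffOn_const).congr
    fun _ hp => dT_eq_fderiv hO hψ hp

theorem dS_dT_comm (hO : IsOpen O)
    (hψ : ContDiffOn ℝ ∞ (fun p : ℝ × ℝ => ψ p.1 p.2) O) {p : ℝ × ℝ} (hp : p ∈ O) :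
    dS (dT ψ) p.1 p.2 = dT (dS ψ) p.1 p.2 := by
  have hc := hψ.contDiffAt (hO.mem_nhds hp)
  have hsymm : IsSymmSndFDerivAt ℝ (fun p : ℝ × ℝ => ψ p.1 p.2) p :=
    hc.isSymmSndFDerivAt 
    (by rw [minSmoothness_of_isRCLikeNormedField]; exact WithTop.coe_le_coe.2 le_top)
  have hd : DifferentiableAt ℝ (fderiv ℝ (fun p : ℝ × ℝ => ψ p.1 p.2)) p :=
    (hc.fderiv_right (m := 1) (by norm_cast)).differentiableAt (by simp)
  have hS : (fun q : ℝ × ℝ => dS ψ q.1 q.2) =ᶠ[nhds p]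
      fun q => fderiv ℝ (fun p : ℝ × ℝ => ψ p.1 p.2) q (1, 0) :=
    Filter.eventuallyEq_of_mem (hO.mem_nhds hp) fun _ hq => dS_eq_fderiv hO hψ hq
  have hT : (fun q : ℝ × ℝ => dT ψ q.1 q.2) =ᶠ[nhds p]
      fun q => fderiv ℝ (fun p : ℝ × ℝ => ψ p.1 p.2) q (0, 1) :=
    Filter.eventuallyEq_of_mem (hO.mem_nhds hp) fun _ hq => dT_eq_fderiv hO hψ hq
  rw [dS_eq_fderiv hO (contDiffOn_dT hO hψ) hp, dT_eq_fderiv hO (contDiffOn_dS hO hψ) hp,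
    hS.fderiv_eq, hT.fderiv_eq, fderiv_clm_apply hd (by fun_prop),
    fderiv_clm_apply hd (by fun_prop)]
  simpa using hsymm.eq (1, 0) (0, 1)

/-- The chain rule for `ψ(s, t)` with `s`, `t` functions on a normed space. -/
theorem hasFDerivAt_comp_uncurried {E : Type*} [NormedAddCommGroup E] [NormedSpace ℝ E]
    (hO : IsOpen O) (hψ : ContDiffOn ℝ ∞ (fun p : ℝ × ℝ => ψ p.1 p.2) O)
    {s t : E → ℝ} {s' t' : E →L[ℝ] ℝ} {e : E} (hs : HasFDerivAt s s' e) (ht : HasFDerivAt t t' e)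
    (hp : (s e, t e) ∈ O) :
    HasFDerivAt (fun e => ψ (s e) (t e)) (dS ψ (s e) (t e) • s' + dT ψ (s e) (t e) • t') e := by
  refine ((hasFDerivAt_uncurried hO hψ hp).comp e (hs.prodMk ht)).congr_fderiv ?_
  ext v
  simp

end TwoVariables

/-! ### Partial derivatives -/

theorem hasFDerivAt_div {E : Type*} [NormedAddCommGroup E] [NormedSpace ℝ E]
    {f g : E → ℝ} {f' g' : E →L[ℝ] ℝ} {e : E} (hf : HasFDerivAt f f' e) (hg : HasFDerivAt g g' e)
    (h : g e ≠ 0) :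
    HasFDerivAt (fun e => f e / g e) ((1 / g e) • f' - (f e / g e ^ 2) • g') e := by
  simp only [div_eq_mul_inv]
  refine (hf.mul ((hasDerivAt_inv h).comp_hasFDerivAt e hg)).congr_fderiv ?_
  ext v
  simp
  ring

variable {n : ℕ}

/-- The directional derivative along `y` at `x`. -/
theorem sum_mul_pd (f : Coord n → ℝ) (x y : Coord n) :
    ∑ k, pd k f x * y k = fderiv ℝ f x y := by
  conv_rhs => rw [pi_eq_sum_univ' y]
  simp [pd, map_sum, mul_comm]

theorem pd_congr {f g : Coord n → ℝ} {x : Coord n} (h : f =ᶠ[nhds x] g) (i : Fin n) :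
    pd i f x = pd i g x := by
  rw [pd, pd, h.fderiv_eq]

/-! ### Scalar identities -/

/-- The coefficients of `Γ₁ b + Γ₂ γ + Ψ⁻¹ Γ₃ α` solve the linear system which the fundamental
tensor induces on the span of `b`, `γ` and `α`. Here `p, p₁, p₂, p₁₁, p₁₂, p₂₂` are the
values of `Ψ` and its partial derivatives. -/
theorem spray_coefficients_solve
    {s t B G T p p₁ p₂ p₁₁ p₁₂ p₂₂ R R' π J bb gg bg Γ r₀ q₀ r₃ r₁ q₁ w₁ w₂ w₃ : ℝ}
    (hp : p ≠ 0) (hπ0 : π ≠ 0) (hπ : π = p - s * p₁ - t * p₂) (hJ : J * π = p₁₁ * p₂₂ - p₁₂ * p₁₂)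
    (hbb : bb = B - s ^ 2) (hgg : gg = G - t ^ 2) (hbg : bg = T - s * t)
    (hΓ : Γ = π + bb * p₁₁ + gg * p₂₂ + 2 * bg * p₁₂ + (bb * gg - bg ^ 2) * J)
    (hr₀ : r₀ = p * p₁₁ + p₁ * p₁) (hq₀ : q₀ = p * p₂₂ + p₂ * p₂)
    (hr₃ : r₃ = p * p₁₂ + p₁ * p₂) (hr₁ : r₁ = p * p₁ - s * r₀ - t * r₃)
    (hq₁ : q₁ = p * p₂ - t * q₀ - s * r₃)
    (hw₁ : w₁ = (p₁₁ + gg * J) * R + (p₁₂ - bg * J) * R')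
    (hw₂ : w₂ = (p₂₂ + bb * J) * R' + (p₁₂ - bg * J) * R)
    (hw₃ : p * w₃ = (r₁ + (p₁ * p₁₂ - p₂ * p₁₁ + t * p * J) * bg
        - (p₂ * p₁₂ - p₁ * p₂₂ + s * p * J) * gg) * R
      + (q₁ - (p₁ * p₁₂ - p₂ * p₁₁ + t * p * J) * bb
        + (p₂ * p₁₂ - p₁ * p₂₂ + s * p * J) * bg) * R') :
    p * π * w₁ + r₀ * (B * w₁ + T * w₂ + s * w₃) + r₃ * (T * w₁ + G * w₂ + t * w₃)
        + r₁ * (s * w₁ + t * w₂ + w₃) = Γ * (r₀ * R + r₃ * R') ∧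
    p * π * w₂ + r₃ * (B * w₁ + T * w₂ + s * w₃) + q₀ * (T * w₁ + G * w₂ + t * w₃)
        + q₁ * (s * w₁ + t * w₂ + w₃) = Γ * (r₃ * R + q₀ * R') ∧
    p * π * w₃ + r₁ * (B * w₁ + T * w₂ + s * w₃) + q₁ * (T * w₁ + G * w₂ + t * w₃)
        - (s * r₁ + t * q₁) * (s * w₁ + t * w₂ + w₃) = Γ * (r₁ * R + q₁ * R') := by
  -- `p` is eliminated instead of `π`, so that the denominators stay monomials
  have hw₃' : w₃ = _ := eq_div_of_mul_eq hp ((mul_comm _ _).trans hw₃)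
  have hJ' : J = (p₁₁ * p₂₂ - p₁₂ * p₁₂) / π := eq_div_of_mul_eq hπ0 hJ
  have hps : p = π + s * p₁ + t * p₂ := by rw [hπ]; ring
  clear hJ hw₃ hπ
  refine ⟨?_, ?_, ?_⟩ <;>
  · subst hΓ hw₁ hw₂ hw₃' hr₁ hq₁ hr₀ hq₀ hr₃ hbb hgg hbg hJ'
    field_simp
    subst hps
    ring

/-- The determinant of the linear map which `g` induces on the span of `b`, `γ` and `α_i`, when
covectors are raised by `a`: its matrix is `Ψ Π` times the identity plus the product of the
coefficient matrix of `g` with the Gram matrix. The variables are as in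
`spray_coefficients_solve`. -/
theorem det_induced_map
    {s t B G T p p₁ p₂ p₁₁ p₁₂ p₂₂ π J bb gg bg Γ r₀ q₀ r₃ r₁ q₁ : ℝ}
    (hπ0 : π ≠ 0) (hπ : π = p - s * p₁ - t * p₂) (hJ : J * π = p₁₁ * p₂₂ - p₁₂ * p₁₂)
    (hbb : bb = B - s ^ 2) (hgg : gg = G - t ^ 2) (hbg : bg = T - s * t)
    (hΓ : Γ = π + bb * p₁₁ + gg * p₂₂ + 2 * bg * p₁₂ + (bb * gg - bg ^ 2) * J)
    (hr₀ : r₀ = p * p₁₁ + p₁ * p₁) (hq₀ : q₀ = p * p₂₂ + p₂ * p₂)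
    (hr₃ : r₃ = p * p₁₂ + p₁ * p₂) (hr₁ : r₁ = p * p₁ - s * r₀ - t * r₃)
    (hq₁ : q₁ = p * p₂ - t * q₀ - s * r₃) :
    ((p * π) • (1 : Matrix (Fin 3) (Fin 3) ℝ)
      + !![r₀, r₃, r₁; r₃, q₀, q₁; r₁, q₁, -(s * r₁ + t * q₁)] * !![B, T, s; T, G, t; s, t, 1]).det
      = p ^ 4 * π * Γ := by
  have hJ' : J = (p₁₁ * p₂₂ - p₁₂ * p₁₂) / π := eq_div_of_mul_eq hπ0 hJ
  have hps : p = π + s * p₁ + t * p₂ := by rw [hπ]; ring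
  clear hJ hπ
  subst hΓ hr₁ hq₁ hr₀ hq₀ hr₃ hbb hgg hbg hJ'
  simp [Matrix.det_fin_three]
  field_simp
  subst hps
  ring

/-! ### Linear algebra of the Riemannian metric -/

theorem dotProduct_mulVec_comm {A : Matrix (Fin n) (Fin n) ℝ} (hA : A.IsSymm) (u v : Coord n) :
    u ⬝ᵥ A *ᵥ v = v ⬝ᵥ A *ᵥ u := by
  rw [Matrix.dotProduct_mulVec, dotProduct_comm, ← Matrix.mulVec_transpose, hA.eq]

theorem formInner_eq (a : Coord n → Matrix (Fin n) (Fin n) ℝ) (w v : Coord n → Coord n)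
    (x : Coord n) : formInner a w v x = w x ⬝ᵥ (a x)⁻¹ *ᵥ v x := by
  simp only [formInner, dotProduct, Matrix.mulVec, Finset.mul_sum]
  refine Finset.sum_congr rfl fun i _ => Finset.sum_congr rfl fun j _ => ?_
  ring

theorem raise_eq (a : Coord n → Matrix (Fin n) (Fin n) ℝ) (x v : Coord n) :
    raise a x v = (a x)⁻¹ *ᵥ v := rfl

/-- The Cauchy–Schwarz inequality `|w(y)| < c α(y)` for a 1-form of norm less than `c`. -/
theorem abs_dotProduct_lt {a : Coord n → Matrix (Fin n) (Fin n) ℝ} {w : Coord n → Coord n}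
    {x y : Coord n} (ha : (a x).PosDef) (hy : y ≠ 0) {c : ℝ} (hc : formNorm a w x < c) :
    |w x ⬝ᵥ y| < c * Real.sqrt (y ⬝ᵥ a x *ᵥ y) := by
  have hsymm : (a x).IsSymm := ha.isHermitian
  set B : Coord n := (a x)⁻¹ *ᵥ w x with hB
  have hdet : IsUnit (a x).det := ha.isUnit.map Matrix.detMonoidHom
  have haB : a x *ᵥ B = w x := by
    rw [hB, Matrix.mulVec_mulVec, Matrix.mul_nonsing_inv _ hdet, Matrix.one_mulVec]
  have hq : 0 < y ⬝ᵥ a x *ᵥ y := by simpa using ha.dotProduct_mulVec_pos hy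
  have hN : formInner a w w x = w x ⬝ᵥ B := formInner_eq _ _ _ _
  have hc0 : 0 < c := (Real.sqrt_nonneg _).trans_lt hc
  have hNc : w x ⬝ᵥ B < c ^ 2 := by
    rw [← hN]; exact (Real.sqrt_lt' hc0).1 hc
  -- positivity of `a` on `q B - w(y) y`, where `q = α(y)²`; this `q` is positive, whereas
  -- `‖w‖²` may be zero
  have hpos := ha.posSemidef.dotProduct_mulVec_nonneg
    ((y ⬝ᵥ a x *ᵥ y) • B - (w x ⬝ᵥ y) • y)
  have hyB : y ⬝ᵥ a x *ᵥ B = w x ⬝ᵥ y := by rw [haB, dotProduct_comm]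
  have hBy : B ⬝ᵥ a x *ᵥ y = w x ⬝ᵥ y := by rw [dotProduct_mulVec_comm hsymm, hyB]
  have hBB : B ⬝ᵥ a x *ᵥ B = w x ⬝ᵥ B := by rw [haB, dotProduct_comm]
  simp only [star_trivial, Matrix.mulVec_sub, Matrix.mulVec_smul, dotProduct_sub, sub_dotProduct,
    smul_dotProduct, dotProduct_smul, smul_eq_mul, hyB, hBy, hBB] at hpos
  have hCS : (w x ⬝ᵥ y) ^ 2 ≤ (y ⬝ᵥ a x *ᵥ y) * (w x ⬝ᵥ B) := by
    have : 0 ≤ (y ⬝ᵥ a x *ᵥ y) * ((y ⬝ᵥ a x *ᵥ y) * (w x ⬝ᵥ B) - (w x ⬝ᵥ y) ^ 2) := by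
      linarith
    have := nonneg_of_mul_nonneg_right this hq
    linarith
  refine abs_lt_of_sq_lt_sq ?_ (by positivity)
  rw [mul_pow, Real.sq_sqrt hq.le]
  nlinarith

namespace ABGData

variable {D : ABGData n} {U : Set (Coord n)} {b₀ g₀ : ℝ}

theorem alpha_eq (D : ABGData n) (x y : Coord n) : D.alpha x y = Real.sqrt (y ⬝ᵥ D.a x *ᵥ y) := by
  simp only [alpha, dotProduct, Matrix.mulVec, Finset.mul_sum]
  congr 1
  refine Finset.sum_congr rfl fun i _ => Finset.sum_congr rfl fun j _ => ?_
  ring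

theorem IsABGMetric.quad_pos (hD : D.IsABGMetric U b₀ g₀) {x y : Coord n} (hx : x ∈ U)
    (hy : y ≠ 0) : 0 < y ⬝ᵥ D.a x *ᵥ y := by
  simpa using (hD.riemannian.posDef x hx).dotProduct_mulVec_pos hy

theorem IsABGMetric.alpha_pos (hD : D.IsABGMetric U b₀ g₀) {x y : Coord n} (hx : x ∈ U)
    (hy : y ≠ 0) : 0 < D.alpha x y := by
  rw [alpha_eq]; exact Real.sqrt_pos.2 (hD.quad_pos hx hy)

/-- `Ψ` is evaluated inside the rectangle on which it is smooth. -/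
theorem IsABGMetric.mem_domain (hD : D.IsABGMetric U b₀ g₀) {x y : Coord n} (hx : x ∈ U)
    (hy : y ≠ 0) :
    (D.s x y, D.t x y) ∈ Set.Ioo (-b₀) b₀ ×ˢ Set.Ioo (-g₀) g₀ := by
  have hα := hD.alpha_pos hx hy
  have key : ∀ {r c : ℝ}, |r| < c * D.alpha x y → r / D.alpha x y ∈ Set.Ioo (-c) c := by
    intro r c h
    rw [Set.mem_Ioo, ← abs_lt, abs_div, abs_of_pos hα, div_lt_iff₀ hα]
    exact h
  refine ⟨key ?_, key ?_⟩ <;> rw [alpha_eq]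
  · exact abs_dotProduct_lt (hD.riemannian.posDef x hx) hy (hD.norm_b x hx)
  · exact abs_dotProduct_lt (hD.riemannian.posDef x hx) hy (hD.norm_c x hx)

/-! ### `F²` as a function of `α²`, `β`, `γ` -/

/-- `∂(F²)/∂(α²) = Ψ Π`, where `F²` is regarded as a function of `α²`, `β`, `γ`. -/
noncomputable def coefQ (D : ABGData n) (x y : Coord n) : ℝ := D.P x y * D.PiFun x y

/-- `½ ∂(F²)/∂β = α Ψ Ψ_s`, where `F²` is regarded as a function of `α²`, `β`, `γ`. -/
noncomputable def coefB (D : ABGData n) (x y : Coord n) : ℝ := D.alpha x y * D.P x y * D.Ps x y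

/-- `½ ∂(F²)/∂γ = α Ψ Ψ_s̄`, where `F²` is regarded as a function of `α²`, `β`, `γ`. -/
noncomputable def coefC (D : ABGData n) (x y : Coord n) : ℝ := D.alpha x y * D.P x y * D.Pt x y

/-- `α² = a_ij y^i y^j`. -/
noncomputable def quad (D : ABGData n) (x y : Coord n) : ℝ := y ⬝ᵥ D.a x *ᵥ y

theorem IsABGMetric.sq_alpha (hD : D.IsABGMetric U b₀ g₀) {x y : Coord n} (hx : x ∈ U)
    (hy : y ≠ 0) : D.alpha x y ^ 2 = D.quad x y := by
  rw [alpha_eq, quad, Real.sq_sqrt (hD.quad_pos hx hy).le]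

section Chain

/- In the chain rules below, `X` and `Y` are the point and the fibre coordinate as functions on a
normed space; one of them is constant when a partial derivative is taken. -/
variable {E : Type*} [NormedAddCommGroup E] [NormedSpace ℝ E] {X Y : E → Coord n} {e : E}
  {Q' β' γ' : E →L[ℝ] ℝ}

theorem IsABGMetric.hasFDerivAt_alpha (hD : D.IsABGMetric U b₀ g₀) (hx : X e ∈ U) (hy : Y e ≠ 0)
    (hQ : HasFDerivAt (fun e => D.quad (X e) (Y e)) Q' e) :
    HasFDerivAt (fun e => D.alpha (X e) (Y e)) ((1 / (2 * D.alpha (X e) (Y e))) • Q') e := by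
  simp only [alpha_eq]
  exact hQ.sqrt (hD.quad_pos hx hy).ne'

theorem IsABGMetric.hasFDerivAt_s (hD : D.IsABGMetric U b₀ g₀) (hx : X e ∈ U) (hy : Y e ≠ 0)
    (hQ : HasFDerivAt (fun e => D.quad (X e) (Y e)) Q' e)
    (hβ : HasFDerivAt (fun e => D.beta (X e) (Y e)) β' e) :
    HasFDerivAt (fun e => D.s (X e) (Y e))
      ((1 / D.alpha (X e) (Y e)) • β'
        - (D.s (X e) (Y e) / (2 * D.alpha (X e) (Y e) ^ 2)) • Q') e := by
  have hα := (hD.alpha_pos hx hy).ne'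
  refine (hasFDerivAt_div hβ (hD.hasFDerivAt_alpha hx hy hQ) hα).congr_fderiv ?_
  ext v
  simp [s]
  field_simp

theorem IsABGMetric.hasFDerivAt_t (hD : D.IsABGMetric U b₀ g₀) (hx : X e ∈ U) (hy : Y e ≠ 0)
    (hQ : HasFDerivAt (fun e => D.quad (X e) (Y e)) Q' e)
    (hγ : HasFDerivAt (fun e => D.gamma (X e) (Y e)) γ' e) :
    HasFDerivAt (fun e => D.t (X e) (Y e))
      ((1 / D.alpha (X e) (Y e)) • γ'
        - (D.t (X e) (Y e) / (2 * D.alpha (X e) (Y e) ^ 2)) • Q') e := by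
  have hα := (hD.alpha_pos hx hy).ne'
  refine (hasFDerivAt_div hγ (hD.hasFDerivAt_alpha hx hy hQ) hα).congr_fderiv ?_
  ext v
  simp [t]
  field_simp

theorem isOpen_domain (b₀ g₀ : ℝ) : IsOpen (Set.Ioo (-b₀) b₀ ×ˢ Set.Ioo (-g₀) g₀) :=
  isOpen_Ioo.prod isOpen_Ioo

section

variable {s' t' : E →L[ℝ] ℝ}

theorem IsABGMetric.hasFDerivAt_P (hD : D.IsABGMetric U b₀ g₀) (hx : X e ∈ U) (hy : Y e ≠ 0)
    (hs : HasFDerivAt (fun e => D.s (X e) (Y e)) s' e)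
    (ht : HasFDerivAt (fun e => D.t (X e) (Y e)) t' e) :
    HasFDerivAt (fun e => D.P (X e) (Y e))
      (D.Ps (X e) (Y e) • s' + D.Pt (X e) (Y e) • t') e :=
  hasFDerivAt_comp_uncurried (isOpen_domain b₀ g₀) hD.smooth_Ψ hs ht (hD.mem_domain hx hy)

theorem IsABGMetric.hasFDerivAt_Ps (hD : D.IsABGMetric U b₀ g₀) (hx : X e ∈ U) (hy : Y e ≠ 0)
    (hs : HasFDerivAt (fun e => D.s (X e) (Y e)) s' e)
    (ht : HasFDerivAt (fun e => D.t (X e) (Y e)) t' e) :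
    HasFDerivAt (fun e => D.Ps (X e) (Y e))
      (D.Pss (X e) (Y e) • s' + D.Pst (X e) (Y e) • t') e :=
  hasFDerivAt_comp_uncurried (isOpen_domain b₀ g₀)
    (contDiffOn_dS (isOpen_domain b₀ g₀) hD.smooth_Ψ) hs ht (hD.mem_domain hx hy)

theorem IsABGMetric.hasFDerivAt_Pt (hD : D.IsABGMetric U b₀ g₀) (hx : X e ∈ U) (hy : Y e ≠ 0)
    (hs : HasFDerivAt (fun e => D.s (X e) (Y e)) s' e)
    (ht : HasFDerivAt (fun e => D.t (X e) (Y e)) t' e) :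
    HasFDerivAt (fun e => D.Pt (X e) (Y e))
      (D.Pst (X e) (Y e) • s' + D.Ptt (X e) (Y e) • t') e := by
  have h := hasFDerivAt_comp_uncurried (isOpen_domain b₀ g₀)
    (contDiffOn_dT (isOpen_domain b₀ g₀) hD.smooth_Ψ) hs ht (hD.mem_domain hx hy)
  rw [dS_dT_comm (isOpen_domain b₀ g₀) hD.smooth_Ψ (hD.mem_domain hx hy)] at h
  exact h

end

/-- `d(F²) = Ψ Π d(α²) + 2 α Ψ Ψ_s dβ + 2 α Ψ Ψ_s̄ dγ`. -/
theorem IsABGMetric.hasFDerivAt_sq_F (hD : D.IsABGMetric U b₀ g₀) (hx : X e ∈ U) (hy : Y e ≠ 0)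
    (hQ : HasFDerivAt (fun e => D.quad (X e) (Y e)) Q' e)
    (hβ : HasFDerivAt (fun e => D.beta (X e) (Y e)) β' e)
    (hγ : HasFDerivAt (fun e => D.gamma (X e) (Y e)) γ' e) :
    HasFDerivAt (fun e => D.F (X e) (Y e) ^ 2)
      (D.coefQ (X e) (Y e) • Q' + (2 * D.coefB (X e) (Y e)) • β'
        + (2 * D.coefC (X e) (Y e)) • γ') e := by
  have hα := (hD.alpha_pos hx hy).ne'
  have hs := hD.hasFDerivAt_s hx hy hQ hβ
  have ht := hD.hasFDerivAt_t hx hy hQ hγ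
  have hF : HasFDerivAt (fun e => D.F (X e) (Y e)) _ e :=
    (hD.hasFDerivAt_alpha hx hy hQ).mul (hD.hasFDerivAt_P hx hy hs ht)
  refine (hF.pow 2).congr_fderiv ?_
  ext v
  simp [coefQ, coefB, coefC, PiFun, F]
  rw [show D.Ψ (D.s (X e) (Y e)) (D.t (X e) (Y e)) = D.P (X e) (Y e) from rfl]
  field_simp
  ring

theorem IsABGMetric.hasFDerivAt_coefQ (hD : D.IsABGMetric U b₀ g₀) (hx : X e ∈ U) (hy : Y e ≠ 0)
    (hQ : HasFDerivAt (fun e => D.quad (X e) (Y e)) Q' e)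
    (hβ : HasFDerivAt (fun e => D.beta (X e) (Y e)) β' e)
    (hγ : HasFDerivAt (fun e => D.gamma (X e) (Y e)) γ' e) :
    HasFDerivAt (fun e => D.coefQ (X e) (Y e))
      ((-(D.s (X e) (Y e) * D.rho1 (X e) (Y e) + D.t (X e) (Y e) * D.rho1Bar (X e) (Y e))
          / (2 * D.alpha (X e) (Y e) ^ 2)) • Q'
        + (D.rho1 (X e) (Y e) / D.alpha (X e) (Y e)) • β'
        + (D.rho1Bar (X e) (Y e) / D.alpha (X e) (Y e)) • γ') e := by
  have hα := (hD.alpha_pos hx hy).ne'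
  have hs := hD.hasFDerivAt_s hx hy hQ hβ
  have ht := hD.hasFDerivAt_t hx hy hQ hγ
  have hP := hD.hasFDerivAt_P hx hy hs ht
  have hPi : HasFDerivAt (fun e => D.PiFun (X e) (Y e)) _ e :=
    (hP.sub (hs.mul (hD.hasFDerivAt_Ps hx hy hs ht))).sub
      (ht.mul (hD.hasFDerivAt_Pt hx hy hs ht))
  refine (hP.mul hPi).congr_fderiv ?_
  ext v
  simp [PiFun, rho1, rho1Bar, rho0, rho0Bar, rho3]
  field_simp
  ring

theorem IsABGMetric.hasFDerivAt_coefB (hD : D.IsABGMetric U b₀ g₀) (hx : X e ∈ U) (hy : Y e ≠ 0)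
    (hQ : HasFDerivAt (fun e => D.quad (X e) (Y e)) Q' e)
    (hβ : HasFDerivAt (fun e => D.beta (X e) (Y e)) β' e)
    (hγ : HasFDerivAt (fun e => D.gamma (X e) (Y e)) γ' e) :
    HasFDerivAt (fun e => D.coefB (X e) (Y e))
      ((D.rho1 (X e) (Y e) / (2 * D.alpha (X e) (Y e))) • Q'
        + D.rho0 (X e) (Y e) • β' + D.rho3 (X e) (Y e) • γ') e := by
  have hα := (hD.alpha_pos hx hy).ne'
  have hs := hD.hasFDerivAt_s hx hy hQ hβ
  have ht := hD.hasFDerivAt_t hx hy hQ hγ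
  have h : HasFDerivAt (fun e => D.coefB (X e) (Y e)) _ e :=
    ((hD.hasFDerivAt_alpha hx hy hQ).mul (hD.hasFDerivAt_P hx hy hs ht)).mul
      (hD.hasFDerivAt_Ps hx hy hs ht)
  refine h.congr_fderiv ?_
  ext v
  simp [rho1, rho0, rho3]
  field_simp
  ring

theorem IsABGMetric.hasFDerivAt_coefC (hD : D.IsABGMetric U b₀ g₀) (hx : X e ∈ U) (hy : Y e ≠ 0)
    (hQ : HasFDerivAt (fun e => D.quad (X e) (Y e)) Q' e)
    (hβ : HasFDerivAt (fun e => D.beta (X e) (Y e)) β' e)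
    (hγ : HasFDerivAt (fun e => D.gamma (X e) (Y e)) γ' e) :
    HasFDerivAt (fun e => D.coefC (X e) (Y e))
      ((D.rho1Bar (X e) (Y e) / (2 * D.alpha (X e) (Y e))) • Q'
        + D.rho3 (X e) (Y e) • β' + D.rho0Bar (X e) (Y e) • γ') e := by
  have hα := (hD.alpha_pos hx hy).ne'
  have hs := hD.hasFDerivAt_s hx hy hQ hβ
  have ht := hD.hasFDerivAt_t hx hy hQ hγ
  have h : HasFDerivAt (fun e => D.coefC (X e) (Y e)) _ e :=
    ((hD.hasFDerivAt_alpha hx hy hQ).mul (hD.hasFDerivAt_P hx hy hs ht)).mul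
      (hD.hasFDerivAt_Pt hx hy hs ht)
  refine h.congr_fderiv ?_
  ext v
  simp [rho1Bar, rho0Bar, rho3]
  field_simp
  ring

end Chain

end ABGData

/-! ### The fundamental tensor -/

/-- The linear form `v ↦ u ⬝ᵥ v`. -/
noncomputable def dotForm (u : Coord n) : Coord n →L[ℝ] ℝ :=
  ∑ i, u i • ContinuousLinearMap.proj i

@[simp]
theorem dotForm_apply (u v : Coord n) : dotForm u v = u ⬝ᵥ v := by
  simp [dotForm, dotProduct]

theorem hasFDerivAt_dotProduct (u y : Coord n) :
    HasFDerivAt (fun w : Coord n => u ⬝ᵥ w) (dotForm u) y := by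
  have h : (fun w : Coord n => u ⬝ᵥ w) = dotForm u := by ext w; simp
  rw [h]
  exact (dotForm u).hasFDerivAt

theorem hasFDerivAt_mulVec_apply (A : Matrix (Fin n) (Fin n) ℝ) (y : Coord n) (i : Fin n) :
    HasFDerivAt (fun w : Coord n => (A *ᵥ w) i) (dotForm (A i)) y :=
  hasFDerivAt_dotProduct (A i) y

theorem hasFDerivAt_quadratic {A : Matrix (Fin n) (Fin n) ℝ} (hA : A.IsSymm) (y : Coord n) :
    HasFDerivAt (fun w : Coord n => w ⬝ᵥ A *ᵥ w) ((2 : ℝ) • dotForm (A *ᵥ y)) y := by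
  have h : HasFDerivAt (fun w : Coord n => ∑ i, w i * (A *ᵥ w) i) _ y :=
    HasFDerivAt.fun_sum fun i _ =>
      (hasFDerivAt_apply (𝕜 := ℝ) i y).mul (hasFDerivAt_mulVec_apply A y i)
  refine h.congr_fderiv ?_
  ext v
  have h1 : ∑ i, y i * A i ⬝ᵥ v = (A *ᵥ y) ⬝ᵥ v := by
    rw [show ∑ i, y i * A i ⬝ᵥ v = y ⬝ᵥ A *ᵥ v from rfl, dotProduct_mulVec_comm hA,
      dotProduct_comm]
  have h2 : ∑ i, (A *ᵥ y) i * v i = (A *ᵥ y) ⬝ᵥ v := rfl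
  simp [Finset.sum_add_distrib, h1, h2, two_mul]

namespace ABGData

variable {D : ABGData n} {U : Set (Coord n)} {b₀ g₀ : ℝ}

theorem IsABGMetric.isSymm (hD : D.IsABGMetric U b₀ g₀) {x : Coord n} (hx : x ∈ U) :
    (D.a x).IsSymm := (hD.riemannian.posDef x hx).isHermitian

/-- `2 g_ij y^i`, the fibre derivative of `F²`. -/
theorem IsABGMetric.pd_sq_F (hD : D.IsABGMetric U b₀ g₀) {x y : Coord n} (hx : x ∈ U)
    (hy : y ≠ 0) (j : Fin n) :
    pd j (fun w => D.F x w ^ 2) y =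
      2 * (D.coefQ x y * (D.a x *ᵥ y) j + D.coefB x y * D.b x j + D.coefC x y * D.c x j) := by
  have h := hD.hasFDerivAt_sq_F (X := fun _ => x) (Y := fun w => w) hx hy
    (hasFDerivAt_quadratic (hD.isSymm hx) y) (hasFDerivAt_dotProduct (D.b x) y)
    (hasFDerivAt_dotProduct (D.c x) y)
  rw [pd, h.fderiv]
  simp
  ring

theorem IsABGMetric.pd_alpha (hD : D.IsABGMetric U b₀ g₀) {x y : Coord n} (hx : x ∈ U)
    (hy : y ≠ 0) (j : Fin n) :
    pd j (D.alpha x) y = (D.a x *ᵥ y) j / D.alpha x y := by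
  have h := hD.hasFDerivAt_alpha (X := fun _ => x) (Y := fun w => w) hx hy
    (hasFDerivAt_quadratic (hD.isSymm hx) y)
  rw [pd, h.fderiv]
  simp
  field_simp

/-- The covector `α_i = a_ij y^j / α`. -/
noncomputable def unitForm (D : ABGData n) (x y : Coord n) (i : Fin n) : ℝ :=
  (D.a x *ᵥ y) i / D.alpha x y

/-- The fundamental tensor differs from `Ψ Π a_ij` by a symmetric bilinear expression in the three
covectors `b`, `γ` and `∂α/∂y`. -/
theorem IsABGMetric.fundamentalTensor_apply (hD : D.IsABGMetric U b₀ g₀) {x y : Coord n}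
    (hx : x ∈ U) (hy : y ≠ 0) (i j : Fin n) :
    fundamentalTensor D.F x y i j = D.coefQ x y * D.a x i j
      + D.rho0 x y * (D.b x i * D.b x j)
      + D.rho3 x y * (D.b x i * D.c x j + D.c x i * D.b x j)
      + D.rho0Bar x y * (D.c x i * D.c x j)
      + D.rho1 x y * (D.b x i * D.unitForm x y j + D.unitForm x y i * D.b x j)
      + D.rho1Bar x y * (D.c x i * D.unitForm x y j + D.unitForm x y i * D.c x j)
      - (D.s x y * D.rho1 x y + D.t x y * D.rho1Bar x y)
          * (D.unitForm x y i * D.unitForm x y j) := by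
  have hα := (hD.alpha_pos hx hy).ne'
  have hev : (fun z => pd j (fun w => D.F x w ^ 2) z) =ᶠ[nhds y] fun z =>
      2 * (D.coefQ x z * (D.a x *ᵥ z) j + D.coefB x z * D.b x j + D.coefC x z * D.c x j) := by
    filter_upwards [isOpen_ne.mem_nhds hy] with z hz using hD.pd_sq_F hx hz j
  have hQ := hasFDerivAt_quadratic (hD.isSymm hx) y
  have hβ := hasFDerivAt_dotProduct (D.b x) y
  have hγ := hasFDerivAt_dotProduct (D.c x) y
  have h := ((((hD.hasFDerivAt_coefQ (X := fun _ => x) (Y := fun w => w) hx hy hQ hβ hγ).mul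
    (hasFDerivAt_mulVec_apply (D.a x) y j)).add
    ((hD.hasFDerivAt_coefB (X := fun _ => x) (Y := fun w => w) hx hy hQ hβ hγ).mul_const
      (D.b x j))).add
    ((hD.hasFDerivAt_coefC (X := fun _ => x) (Y := fun w => w) hx hy hQ hβ hγ).mul_const
      (D.c x j))).const_mul 2
  rw [fundamentalTensor, Matrix.of_apply, pd_congr hev, pd]
  erw [h.fderiv]
  simp [unitForm, (hD.isSymm hx).apply i j]
  field_simp
  ring

theorem IsABGMetric.fundamentalTensor_mulVec (hD : D.IsABGMetric U b₀ g₀) {x y : Coord n}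
    (hx : x ∈ U) (hy : y ≠ 0) (v : Coord n) :
    fundamentalTensor D.F x y *ᵥ v = D.coefQ x y • (D.a x *ᵥ v)
      + (D.rho0 x y * (D.b x ⬝ᵥ v) + D.rho3 x y * (D.c x ⬝ᵥ v)
          + D.rho1 x y * (D.unitForm x y ⬝ᵥ v)) • D.b x
      + (D.rho3 x y * (D.b x ⬝ᵥ v) + D.rho0Bar x y * (D.c x ⬝ᵥ v)
          + D.rho1Bar x y * (D.unitForm x y ⬝ᵥ v)) • D.c x
      + (D.rho1 x y * (D.b x ⬝ᵥ v) + D.rho1Bar x y * (D.c x ⬝ᵥ v)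
          - (D.s x y * D.rho1 x y + D.t x y * D.rho1Bar x y) * (D.unitForm x y ⬝ᵥ v))
        • D.unitForm x y := by
  ext i
  simp only [Matrix.mulVec, dotProduct, Pi.add_apply, Pi.smul_apply, smul_eq_mul, Finset.mul_sum,
    Finset.sum_mul, ← Finset.sum_add_distrib, ← Finset.sum_sub_distrib]
  refine Finset.sum_congr rfl fun j _ => ?_
  rw [hD.fundamentalTensor_apply hx hy]
  ring

/-- The fundamental tensor of a Riemannian metric is the metric itself, at `y = 0` as well since
`α²` is a polynomial in `y`. -/
theorem IsABGMetric.fundamentalTensor_alpha (hD : D.IsABGMetric U b₀ g₀) {x : Coord n}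
    (hx : x ∈ U) (y : Coord n) : fundamentalTensor D.alpha x y = D.a x := by
  have hsq : (fun w => D.alpha x w ^ 2) = fun w => w ⬝ᵥ D.a x *ᵥ w := by
    ext w
    rw [alpha_eq, Real.sq_sqrt]
    simpa using (hD.riemannian.posDef x hx).posSemidef.dotProduct_mulVec_nonneg w
  ext i j
  have h1 : ∀ z, pd j (fun w => D.alpha x w ^ 2) z = 2 * (D.a x *ᵥ z) j := by
    intro z
    rw [pd, hsq, (hasFDerivAt_quadratic (hD.isSymm hx) z).fderiv]
    simp
  simp only [fundamentalTensor, Matrix.of_apply, h1]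
  rw [pd, ((hasFDerivAt_mulVec_apply (D.a x) y j).const_mul 2).fderiv]
  simp [(hD.isSymm hx).apply i j]

/-! ### Differentiability along the base -/

theorem IsABGMetric.differentiableAt_a (hD : D.IsABGMetric U b₀ g₀) (hU : IsOpen U) {x : Coord n}
    (hx : x ∈ U) (i j : Fin n) : DifferentiableAt ℝ (fun z => D.a z i j) x :=
  ((hD.riemannian.smooth i j).contDiffAt (hU.mem_nhds hx)).differentiableAt (by simp)

theorem IsABGMetric.differentiableAt_b (hD : D.IsABGMetric U b₀ g₀) (hU : IsOpen U) {x : Coord n}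
    (hx : x ∈ U) (i : Fin n) : DifferentiableAt ℝ (fun z => D.b z i) x :=
  ((hD.smooth_b i).contDiffAt (hU.mem_nhds hx)).differentiableAt (by simp)

theorem IsABGMetric.differentiableAt_c (hD : D.IsABGMetric U b₀ g₀) (hU : IsOpen U) {x : Coord n}
    (hx : x ∈ U) (i : Fin n) : DifferentiableAt ℝ (fun z => D.c z i) x :=
  ((hD.smooth_c i).contDiffAt (hU.mem_nhds hx)).differentiableAt (by simp)

theorem IsABGMetric.differentiableAt_mulVec (hD : D.IsABGMetric U b₀ g₀) (hU : IsOpen U)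
    {x : Coord n} (hx : x ∈ U) (y : Coord n) (i : Fin n) :
    DifferentiableAt ℝ (fun z => (D.a z *ᵥ y) i) x :=
  DifferentiableAt.fun_sum (u := Finset.univ) fun j _ =>
    (hD.differentiableAt_a hU hx i j).mul_const (y j)

theorem IsABGMetric.differentiableAt_quad (hD : D.IsABGMetric U b₀ g₀) (hU : IsOpen U)
    {x : Coord n} (hx : x ∈ U) (y : Coord n) : DifferentiableAt ℝ (fun z => D.quad z y) x :=
  DifferentiableAt.fun_sum (u := Finset.univ) fun j _ =>
    (hD.differentiableAt_mulVec hU hx y j).const_mul (y j)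

theorem IsABGMetric.differentiableAt_beta (hD : D.IsABGMetric U b₀ g₀) (hU : IsOpen U)
    {x : Coord n} (hx : x ∈ U) (y : Coord n) : DifferentiableAt ℝ (fun z => D.beta z y) x :=
  DifferentiableAt.fun_sum (u := Finset.univ) fun j _ =>
    (hD.differentiableAt_b hU hx j).mul_const (y j)

theorem IsABGMetric.differentiableAt_gamma (hD : D.IsABGMetric U b₀ g₀) (hU : IsOpen U)
    {x : Coord n} (hx : x ∈ U) (y : Coord n) : DifferentiableAt ℝ (fun z => D.gamma z y) x :=
  DifferentiableAt.fun_sum (u := Finset.univ) fun j _ =>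
    (hD.differentiableAt_c hU hx j).mul_const (y j)

/-- The explicit formula for `g_ij` involves second derivatives of `Ψ`, which are differentiable. -/
theorem IsABGMetric.differentiableAt_fundamentalTensor (hD : D.IsABGMetric U b₀ g₀)
    (hU : IsOpen U) {x y : Coord n} (hx : x ∈ U) (hy : y ≠ 0) (i j : Fin n) :
    DifferentiableAt ℝ (fun z => fundamentalTensor D.F z y i j) x := by
  have hQ := (hD.differentiableAt_quad hU hx y).hasFDerivAt
  have hβ := (hD.differentiableAt_beta hU hx y).hasFDerivAt
  have hγ := (hD.differentiableAt_gamma hU hx y).hasFDerivAt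
  have hO := isOpen_domain b₀ g₀
  have hs' := hD.hasFDerivAt_s (X := fun z => z) (Y := fun _ => y) hx hy hQ hβ
  have ht' := hD.hasFDerivAt_t (X := fun z => z) (Y := fun _ => y) hx hy hQ hγ
  have hmem := hD.mem_domain hx hy
  have hΨs := contDiffOn_dS hO hD.smooth_Ψ
  have hΨt := contDiffOn_dT hO hD.smooth_Ψ
  have hss : DifferentiableAt ℝ (fun z => D.Pss z y) x :=
    (hasFDerivAt_comp_uncurried hO (contDiffOn_dS hO hΨs) hs' ht' hmem).differentiableAt
  have hst : DifferentiableAt ℝ (fun z => D.Pst z y) x :=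
    (hasFDerivAt_comp_uncurried hO (contDiffOn_dT hO hΨs) hs' ht' hmem).differentiableAt
  have htt : DifferentiableAt ℝ (fun z => D.Ptt z y) x :=
    (hasFDerivAt_comp_uncurried hO (contDiffOn_dT hO hΨt) hs' ht' hmem).differentiableAt
  have hP := (hD.hasFDerivAt_P (X := fun z => z) (Y := fun _ => y) hx hy hs' ht').differentiableAt
  have hPs :=
    (hD.hasFDerivAt_Ps (X := fun z => z) (Y := fun _ => y) hx hy hs' ht').differentiableAt
  have hPt :=
    (hD.hasFDerivAt_Pt (X := fun z => z) (Y := fun _ => y) hx hy hs' ht').differentiableAt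
  have hs := hs'.differentiableAt
  have ht := ht'.differentiableAt
  have h0 : DifferentiableAt ℝ (fun z => D.rho0 z y) x := (hP.mul hss).add (hPs.mul hPs)
  have h0' : DifferentiableAt ℝ (fun z => D.rho0Bar z y) x := (hP.mul htt).add (hPt.mul hPt)
  have h3 : DifferentiableAt ℝ (fun z => D.rho3 z y) x := (hP.mul hst).add (hPs.mul hPt)
  have h1 : DifferentiableAt ℝ (fun z => D.rho1 z y) x :=
    ((hP.mul hPs).sub (hs.mul h0)).sub (ht.mul h3)
  have h1' : DifferentiableAt ℝ (fun z => D.rho1Bar z y) x :=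
    ((hP.mul hPt).sub (ht.mul h0')).sub (hs.mul h3)
  have hq := (hD.hasFDerivAt_coefQ (X := fun z => z) (Y := fun _ => y) hx hy hQ hβ
    hγ).differentiableAt
  have hl : ∀ k, DifferentiableAt ℝ (fun z => D.unitForm z y k) x := fun k =>
    (hasFDerivAt_div (hD.differentiableAt_mulVec hU hx y k).hasFDerivAt
      (hD.hasFDerivAt_alpha (X := fun z => z) (Y := fun _ => y) hx hy hQ)
      (hD.alpha_pos hx hy).ne').differentiableAt
  have hb := hD.differentiableAt_b hU hx
  have hc := hD.differentiableAt_c hU hx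
  have hev : (fun z => fundamentalTensor D.F z y i j) =ᶠ[nhds x] _ :=
    Filter.eventuallyEq_of_mem (hU.mem_nhds hx) fun z hz =>
      hD.fundamentalTensor_apply hz hy i j
  refine DifferentiableAt.congr_of_eventuallyEq ?_ hev
  exact ((((((hq.mul (hD.differentiableAt_a hU hx i j)).add
    (h0.mul ((hb i).mul (hb j)))).add
    (h3.mul (((hb i).mul (hc j)).add ((hc i).mul (hb j))))).add
    (h0'.mul ((hc i).mul (hc j)))).add
    (h1.mul (((hb i).mul (hl j)).add ((hl i).mul (hb j))))).add
    (h1'.mul (((hc i).mul (hl j)).add ((hl i).mul (hc j))))).sub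
    (((hs.mul h1).add (ht.mul h1')).mul ((hl i).mul (hl j)))

end ABGData

/-! ### Spray coefficients and covariant derivatives -/

theorem pd_mulVec_apply {G : Coord n → Matrix (Fin n) (Fin n) ℝ} {x : Coord n}
    (hG : ∀ i j, DifferentiableAt ℝ (fun z => G z i j) x) (y : Coord n) (k l : Fin n) :
    pd k (fun z => (G z *ᵥ y) l) x = ∑ j, pd k (fun z => G z l j) x * y j := by
  have h : HasFDerivAt (fun z => ∑ j, G z l j * y j) _ x :=
    HasFDerivAt.fun_sum fun j _ => (hG l j).hasFDerivAt.mul_const (y j)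
  rw [pd, show (fun z => (G z *ᵥ y) l) = fun z => ∑ j, G z l j * y j from rfl, h.fderiv]
  simp [pd, mul_comm]

theorem pd_dotProduct_const {w : Coord n → Coord n} {x : Coord n}
    (hw : ∀ i, DifferentiableAt ℝ (fun z => w z i) x) (y : Coord n) (k : Fin n) :
    pd k (fun z => w z ⬝ᵥ y) x = ∑ i, pd k (fun z => w z i) x * y i := by
  have h : HasFDerivAt (fun z => ∑ i, w z i * y i) _ x :=
    HasFDerivAt.fun_sum fun i _ => (hw i).hasFDerivAt.mul_const (y i)
  rw [pd, show (fun z => w z ⬝ᵥ y) = fun z => ∑ i, w z i * y i from rfl, h.fderiv]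
  simp [pd, mul_comm]

theorem differentiableAt_mulVec_apply {G : Coord n → Matrix (Fin n) (Fin n) ℝ} {x : Coord n}
    (hG : ∀ i j, DifferentiableAt ℝ (fun z => G z i j) x) (y : Coord n) (l : Fin n) :
    DifferentiableAt ℝ (fun z => (G z *ᵥ y) l) x :=
  DifferentiableAt.fun_sum (u := Finset.univ) fun j _ => (hG l j).mul_const (y j)

/-- For a field `G` of symmetric matrices, the contraction with `y^i y^j` of the Christoffel
symbols of the first kind. -/
theorem sum_christoffel_lower {G : Coord n → Matrix (Fin n) (Fin n) ℝ} {x : Coord n}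
    (hG : ∀ i j, DifferentiableAt ℝ (fun z => G z i j) x)
    (hsymm : ∀ᶠ z in nhds x, (G z).IsSymm) (y : Coord n) (l : Fin n) :
    ∑ i, ∑ j, (pd i (fun z => G z j l) x + pd j (fun z => G z i l) x - pd l (fun z => G z i j) x)
        * y i * y j
      = 2 * fderiv ℝ (fun z => (G z *ᵥ y) l) x y - pd l (fun z => y ⬝ᵥ G z *ᵥ y) x := by
  have hs : ∀ k i j, pd k (fun z => G z i j) x = pd k (fun z => G z j i) x := fun k i j =>
    pd_congr (hsymm.mono fun z hz => hz.apply j i) k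
  have h1 : fderiv ℝ (fun z => (G z *ᵥ y) l) x y
      = ∑ i, ∑ j, pd i (fun z => G z j l) x * y i * y j := by
    rw [← sum_mul_pd]
    simp only [pd_mulVec_apply hG, Finset.sum_mul]
    refine Finset.sum_congr rfl fun i _ => Finset.sum_congr rfl fun j _ => ?_
    rw [hs i l j]
    ring
  have h2 : pd l (fun z => y ⬝ᵥ G z *ᵥ y) x
      = ∑ i, ∑ j, pd l (fun z => G z i j) x * y i * y j := by
    have hc : (fun z => y ⬝ᵥ G z *ᵥ y) = fun z => (G z *ᵥ y) ⬝ᵥ y := by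
      ext z; exact dotProduct_comm _ _
    rw [hc, pd_dotProduct_const (w := fun z => G z *ᵥ y)
      (differentiableAt_mulVec_apply hG y)]
    simp only [pd_mulVec_apply hG, Finset.sum_mul]
    refine Finset.sum_congr rfl fun i _ => Finset.sum_congr rfl fun j _ => ?_
    ring
  have h3 : ∑ i, ∑ j, pd j (fun z => G z i l) x * y i * y j
      = ∑ i, ∑ j, pd i (fun z => G z j l) x * y i * y j := by
    rw [Finset.sum_comm]
    refine Finset.sum_congr rfl fun i _ => Finset.sum_congr rfl fun j _ => ?_
    ring
  simp only [sub_mul, add_mul, Finset.sum_add_distrib, Finset.sum_sub_distrib]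
  rw [h1, h2, h3]
  ring

/-- The spray coefficients in terms of the field `z ↦ G z y` of fundamental tensors. -/
theorem sprayCoeff_eq_mulVec {F : Coord n → Coord n → ℝ} {x y : Coord n}
    (hG : ∀ i j, DifferentiableAt ℝ (fun z => fundamentalTensor F z y i j) x)
    (hsymm : ∀ᶠ z in nhds x, (fundamentalTensor F z y).IsSymm) :
    sprayCoeff F x y = (fundamentalTensor F x y)⁻¹ *ᵥ fun l =>
      (1 / 4) * (2 * fderiv ℝ (fun z => (fundamentalTensor F z y *ᵥ y) l) x y
        - pd l (fun z => y ⬝ᵥ fundamentalTensor F z y *ᵥ y) x) := by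
  ext i
  rw [sprayCoeff, Finset.mul_sum, Matrix.mulVec, dotProduct]
  refine Finset.sum_congr rfl fun l _ => ?_
  rw [← sum_christoffel_lower hG hsymm, Finset.sum_comm]
  have hs : ∀ k i j, pd k (fun z => fundamentalTensor F z y i j) x
      = pd k (fun z => fundamentalTensor F z y j i) x := fun k i j =>
    pd_congr (hsymm.mono fun z hz => hz.apply j i) k
  have h : ∀ k j, (pd k (fun z => fundamentalTensor F z y j l) x
      + pd j (fun z => fundamentalTensor F z y l k) x
      - pd l (fun z => fundamentalTensor F z y j k) x) * y j * y k =
      (pd k (fun z => fundamentalTensor F z y j l) x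
      + pd j (fun z => fundamentalTensor F z y k l) x
      - pd l (fun z => fundamentalTensor F z y k j) x) * y k * y j := by
    intro k j
    rw [hs j l k, hs l j k]
    ring
  simp only [h]
  ring

section Covariant

variable {a : Coord n → Matrix (Fin n) (Fin n) ℝ} {x : Coord n}

theorem christoffel_comm (hsymm : ∀ᶠ z in nhds x, (a z).IsSymm) (k i j : Fin n) :
    christoffel a x k i j = christoffel a x k j i := by
  have hs : ∀ l, pd l (fun z => a z i j) x = pd l (fun z => a z j i) x := fun l =>
    pd_congr (hsymm.mono fun z hz => hz.apply j i) l
  simp only [christoffel]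
  congr 1
  refine Finset.sum_congr rfl fun l _ => ?_
  rw [hs l]
  ring

/-- `Γ^k_ij y^i y^j` is twice the spray coefficient of `a`. -/
theorem sum_christoffel (ha : ∀ i j, DifferentiableAt ℝ (fun z => a z i j) x)
    (hsymm : ∀ᶠ z in nhds x, (a z).IsSymm) (y : Coord n) (k : Fin n) :
    ∑ i, ∑ j, christoffel a x k i j * y i * y j =
      2 * ((a x)⁻¹ *ᵥ fun l => (1 / 4) * (2 * fderiv ℝ (fun z => (a z *ᵥ y) l) x y
        - pd l (fun z => y ⬝ᵥ a z *ᵥ y) x)) k := by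
  simp only [← sum_christoffel_lower ha hsymm]
  simp only [christoffel, Matrix.mulVec, dotProduct, Finset.mul_sum, Finset.sum_mul]
  conv_lhs =>
    enter [2, i]
    rw [Finset.sum_comm]
  rw [Finset.sum_comm]
  refine Finset.sum_congr rfl fun l _ => ?_
  refine Finset.sum_congr rfl fun i _ => Finset.sum_congr rfl fun j _ => ?_
  ring

/-- `r_00` is the derivative of the function `w_i y^i` along the geodesic spray of `a`. -/
theorem r00_eq {w : Coord n → Coord n} (hw : ∀ i, DifferentiableAt ℝ (fun z => w z i) x)
    (ha : ∀ i j, DifferentiableAt ℝ (fun z => a z i j) x)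
    (hsymm : ∀ᶠ z in nhds x, (a z).IsSymm) (y : Coord n) :
    r00 a w x y = fderiv ℝ (fun z => w z ⬝ᵥ y) x y
      - 2 * (w x ⬝ᵥ (a x)⁻¹ *ᵥ fun l => (1 / 4) * (2 * fderiv ℝ (fun z => (a z *ᵥ y) l) x y
        - pd l (fun z => y ⬝ᵥ a z *ᵥ y) x)) := by
  have h1 : r00 a w x y = ∑ i, ∑ j, covDeriv a w x i j * y i * y j := by
    have hcomm : ∑ i, ∑ j, covDeriv a w x j i * y i * y j
        = ∑ i, ∑ j, covDeriv a w x i j * y i * y j := by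
      rw [Finset.sum_comm]
      refine Finset.sum_congr rfl fun i _ => Finset.sum_congr rfl fun j _ => ?_
      ring
    have : r00 a w x y = (1 / 2) * (∑ i, ∑ j, covDeriv a w x i j * y i * y j
        + ∑ i, ∑ j, covDeriv a w x j i * y i * y j) := by
      simp only [r00, symPart, ← Finset.sum_add_distrib, Finset.mul_sum]
      refine Finset.sum_congr rfl fun i _ => Finset.sum_congr rfl fun j _ => ?_
      ring
    rw [this, hcomm]
    ring
  have h2 : fderiv ℝ (fun z => w z ⬝ᵥ y) x y
      = ∑ i, ∑ j, pd j (fun z => w z i) x * y i * y j := by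
    rw [← sum_mul_pd]
    simp only [pd_dotProduct_const hw, Finset.sum_mul]
    rw [Finset.sum_comm]
  have h3 : ∑ i, ∑ j, (∑ k, christoffel a x k i j * w x k) * y i * y j
      = ∑ k, w x k * ∑ i, ∑ j, christoffel a x k i j * y i * y j := by
    simp only [Finset.sum_mul, Finset.mul_sum]
    conv_lhs =>
      enter [2, i]
      rw [Finset.sum_comm]
    rw [Finset.sum_comm]
    refine Finset.sum_congr rfl fun l _ => ?_
    refine Finset.sum_congr rfl fun i _ => Finset.sum_congr rfl fun j _ => ?_
    ring
  rw [h1, h2]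
  simp only [covDeriv, sub_mul, Finset.sum_sub_distrib]
  rw [h3]
  simp only [sum_christoffel ha hsymm]
  rw [dotProduct, Finset.mul_sum]
  congr 1
  refine Finset.sum_congr rfl fun k _ => ?_
  ring

/-- The Christoffel symbols cancel in the exterior derivative of `w`. -/
theorem sLow0_eq {w : Coord n → Coord n} (hw : ∀ i, DifferentiableAt ℝ (fun z => w z i) x)
    (hsymm : ∀ᶠ z in nhds x, (a z).IsSymm) (y : Coord n) (l : Fin n) :
    sLow0 a w x y l
      = (1 / 2) * (fderiv ℝ (fun z => w z l) x y - pd l (fun z => w z ⬝ᵥ y) x) := by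
  rw [← sum_mul_pd, pd_dotProduct_const hw, ← Finset.sum_sub_distrib, Finset.mul_sum, sLow0]
  refine Finset.sum_congr rfl fun j _ => ?_
  simp only [skewPart, covDeriv, fun k => christoffel_comm hsymm k j l]
  ring

theorem dotProduct_sLow0 (a : Coord n → Matrix (Fin n) (Fin n) ℝ) (w : Coord n → Coord n)
    (x y : Coord n) : y ⬝ᵥ sLow0 a w x y = 0 := by
  have h : y ⬝ᵥ sLow0 a w x y = -(y ⬝ᵥ sLow0 a w x y) := by
    simp only [dotProduct, sLow0, Finset.mul_sum, ← Finset.sum_neg_distrib]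
    rw [Finset.sum_comm]
    refine Finset.sum_congr rfl fun i _ => Finset.sum_congr rfl fun j _ => ?_
    simp only [skewPart]
    ring
  linarith

theorem s0_eq (hsymm : (a x)⁻¹.IsSymm) (w : Coord n → Coord n) (y : Coord n) :
    s0 a w x y = w x ⬝ᵥ sUp0 a w x y := by
  have h1 : s0 a w x y = raise a x (w x) ⬝ᵥ sLow0 a w x y := by
    simp only [s0, dotProduct, sLow0, Finset.mul_sum, Finset.sum_mul]
    rw [Finset.sum_comm]
    refine Finset.sum_congr rfl fun i _ => Finset.sum_congr rfl fun j _ => ?_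
    ring
  rw [h1, raise_eq, show sUp0 a w x y = (a x)⁻¹ *ᵥ sLow0 a w x y from rfl,
    dotProduct_mulVec_comm hsymm, dotProduct_comm, dotProduct_comm]

theorem sMixed0_eq (w v : Coord n → Coord n) (y : Coord n) :
    sMixed0 a w v x y = v x ⬝ᵥ sUp0 a w x y :=
  dotProduct_comm _ _

end Covariant

/-! ### Contractions, and the non-vanishing of `Π` and `Γ` -/

namespace ABGData

variable {D : ABGData n} {U : Set (Coord n)} {b₀ g₀ : ℝ}

theorem IsABGMetric.P_pos (hD : D.IsABGMetric U b₀ g₀) {x y : Coord n} (hx : x ∈ U)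
    (hy : y ≠ 0) : 0 < D.P x y :=
  hD.pos_Ψ _ (hD.mem_domain hx hy).1 _ (hD.mem_domain hx hy).2

theorem IsABGMetric.dotProduct_b (hD : D.IsABGMetric U b₀ g₀) {x y : Coord n} (hx : x ∈ U)
    (hy : y ≠ 0) : D.b x ⬝ᵥ y = D.alpha x y * D.s x y :=
  (mul_div_cancel₀ (D.b x ⬝ᵥ y) (hD.alpha_pos hx hy).ne').symm

theorem IsABGMetric.dotProduct_c (hD : D.IsABGMetric U b₀ g₀) {x y : Coord n} (hx : x ∈ U)
    (hy : y ≠ 0) : D.c x ⬝ᵥ y = D.alpha x y * D.t x y :=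
  (mul_div_cancel₀ (D.c x ⬝ᵥ y) (hD.alpha_pos hx hy).ne').symm

theorem IsABGMetric.mulVec_eq (hD : D.IsABGMetric U b₀ g₀) {x y : Coord n} (hx : x ∈ U)
    (hy : y ≠ 0) : D.a x *ᵥ y = D.alpha x y • D.unitForm x y := by
  ext i
  exact (mul_div_cancel₀ _ (hD.alpha_pos hx hy).ne').symm

theorem IsABGMetric.unitForm_dotProduct (hD : D.IsABGMetric U b₀ g₀) {x y : Coord n} (hx : x ∈ U)
    (hy : y ≠ 0) : D.unitForm x y ⬝ᵥ y = D.alpha x y := by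
  have hα := (hD.alpha_pos hx hy).ne'
  have h : D.alpha x y * (D.unitForm x y ⬝ᵥ y) = D.alpha x y * D.alpha x y := by
    rw [← smul_eq_mul, ← smul_dotProduct, ← hD.mulVec_eq hx hy, dotProduct_comm, ← sq,
      hD.sq_alpha hx hy, quad]
  exact mul_left_cancel₀ hα h

theorem IsABGMetric.isUnit_det (hD : D.IsABGMetric U b₀ g₀) {x : Coord n} (hx : x ∈ U) :
    IsUnit (D.a x).det := (hD.riemannian.posDef x hx).isUnit.map Matrix.detMonoidHom

theorem IsABGMetric.mulVec_inv (hD : D.IsABGMetric U b₀ g₀) {x : Coord n} (hx : x ∈ U)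
    (v : Coord n) : D.a x *ᵥ (D.a x)⁻¹ *ᵥ v = v := by
  rw [Matrix.mulVec_mulVec, Matrix.mul_nonsing_inv _ (hD.isUnit_det hx), Matrix.one_mulVec]

theorem IsABGMetric.isSymm_inv (hD : D.IsABGMetric U b₀ g₀) {x : Coord n} (hx : x ∈ U) :
    ((D.a x)⁻¹).IsSymm := (hD.riemannian.posDef x hx).inv.isHermitian

/-- `α_i a^{ij} v_j = v(y) / α`. -/
theorem IsABGMetric.unitForm_dotProduct_inv (hD : D.IsABGMetric U b₀ g₀) {x y : Coord n}
    (hx : x ∈ U) (v : Coord n) :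
    D.unitForm x y ⬝ᵥ (D.a x)⁻¹ *ᵥ v = (v ⬝ᵥ y) / D.alpha x y := by
  have h : D.unitForm x y = (D.alpha x y)⁻¹ • (D.a x *ᵥ y) := by
    ext i
    simp [unitForm, div_eq_inv_mul]
  rw [h, smul_dotProduct, dotProduct_comm, dotProduct_mulVec_comm (hD.isSymm hx),
    hD.mulVec_inv hx, dotProduct_comm, smul_eq_mul, div_eq_inv_mul]

/-- The Gram matrix of `b`, `γ`, `α_i` with respect to `a^{ij}`. -/
theorem IsABGMetric.gram (hD : D.IsABGMetric U b₀ g₀) {x y : Coord n}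
    (hx : x ∈ U) (hy : y ≠ 0) :
    D.b x ⬝ᵥ D.bUp x = D.bSq x ∧ D.b x ⬝ᵥ D.cUp x = D.theta x ∧
    D.c x ⬝ᵥ D.bUp x = D.theta x ∧ D.c x ⬝ᵥ D.cUp x = D.gSq x ∧
    D.unitForm x y ⬝ᵥ D.bUp x = D.s x y ∧ D.unitForm x y ⬝ᵥ D.cUp x = D.t x y ∧
    D.b x ⬝ᵥ (D.a x)⁻¹ *ᵥ D.unitForm x y = D.s x y ∧
    D.c x ⬝ᵥ (D.a x)⁻¹ *ᵥ D.unitForm x y = D.t x y ∧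
    D.unitForm x y ⬝ᵥ (D.a x)⁻¹ *ᵥ D.unitForm x y = 1 := by
  have hα := (hD.alpha_pos hx hy).ne'
  have h1 : D.unitForm x y ⬝ᵥ D.bUp x = D.s x y := hD.unitForm_dotProduct_inv hx (D.b x)
  have h2 : D.unitForm x y ⬝ᵥ D.cUp x = D.t x y := hD.unitForm_dotProduct_inv hx (D.c x)
  refine ⟨(formInner_eq _ _ _ _).symm, (formInner_eq _ _ _ _).symm, ?_,
    (formInner_eq _ _ _ _).symm, h1, h2, ?_, ?_, ?_⟩
  · rw [theta, formInner_eq, dotProduct_mulVec_comm (hD.isSymm_inv hx)]; rfl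
  · rw [dotProduct_mulVec_comm (hD.isSymm_inv hx)]; exact h1
  · rw [dotProduct_mulVec_comm (hD.isSymm_inv hx)]; exact h2
  · rw [hD.unitForm_dotProduct_inv hx, hD.unitForm_dotProduct hx hy, div_self hα]

/-- `g_ij y^j = ½ ∂(F²)/∂y^i`. -/
theorem IsABGMetric.fundamentalTensor_mulVec_self (hD : D.IsABGMetric U b₀ g₀) {x y : Coord n}
    (hx : x ∈ U) (hy : y ≠ 0) :
    fundamentalTensor D.F x y *ᵥ y =
      D.coefQ x y • (D.a x *ᵥ y) + D.coefB x y • D.b x + D.coefC x y • D.c x := by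
  rw [hD.fundamentalTensor_mulVec hx hy, hD.dotProduct_b hx hy, hD.dotProduct_c hx hy,
    hD.unitForm_dotProduct hx hy]
  ext i
  simp only [Pi.add_apply, Pi.smul_apply, smul_eq_mul, coefB, coefC, rho1, rho1Bar]
  ring

/-- `g_ij y^i y^j = F²`. -/
theorem IsABGMetric.dotProduct_fundamentalTensor_mulVec_self (hD : D.IsABGMetric U b₀ g₀)
    {x y : Coord n} (hx : x ∈ U) (hy : y ≠ 0) :
    y ⬝ᵥ fundamentalTensor D.F x y *ᵥ y = D.F x y ^ 2 := by
  rw [hD.fundamentalTensor_mulVec_self hx hy, hD.mulVec_eq hx hy, dotProduct_comm]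
  simp only [add_dotProduct, smul_dotProduct, smul_eq_mul, hD.dotProduct_b hx hy,
    hD.dotProduct_c hx hy, hD.unitForm_dotProduct hx hy]
  rw [show D.F x y = D.alpha x y * D.P x y from rfl]
  simp only [coefQ, coefB, coefC, PiFun]
  ring

/-- `F²` is strictly convex along a direction `v` annihilated by `β` and `γ`; since its derivative
along `v` is `2 Ψ Π a(y, v)`, the factor `Π` cannot vanish. -/
theorem IsABGMetric.PiFun_ne_zero_of_annihilated (hD : D.IsABGMetric U b₀ g₀) {x y : Coord n}
    (hx : x ∈ U) (hy : y ≠ 0) {v : Coord n} (hv : v ≠ 0) (hbv : D.b x ⬝ᵥ v = 0)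
    (hcv : D.c x ⬝ᵥ v = 0) : D.PiFun x y ≠ 0 := by
  have hq : 0 < v ⬝ᵥ D.a x *ᵥ v := hD.quad_pos hx hv
  set q := v ⬝ᵥ D.a x *ᵥ v with hqdef
  set r := (y ⬝ᵥ D.a x *ᵥ v) / q with hr
  -- `w` is the part of `y` orthogonal to `v`
  set w : Coord n := y - r • v with hw
  have hyw : y = w + r • v := by rw [hw]; abel
  have hwv : w ⬝ᵥ D.a x *ᵥ v = 0 := by
    rw [hw, sub_dotProduct, smul_dotProduct, smul_eq_mul, ← hqdef, hr, div_mul_cancel₀ _ hq.ne',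
      sub_self]
  -- if `y` is parallel to `v`, the line meets the origin, but then `s = s̄ = 0` and `Π = Ψ`
  by_cases hw0 : w = 0
  · rw [hw0, zero_add] at hyw
    have hs : D.s x y = 0 := by
      rw [s, show D.beta x y = D.b x ⬝ᵥ y from rfl, hyw, dotProduct_smul, hbv]; simp
    have ht : D.t x y = 0 := by
      rw [t, show D.gamma x y = D.c x ⬝ᵥ y from rfl, hyw, dotProduct_smul, hcv]; simp
    rw [PiFun, hs, ht]
    simpa using (hD.P_pos hx hy).ne'
  have hline : ∀ τ : ℝ, (w + τ • v) ⬝ᵥ D.a x *ᵥ v = τ * q := by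
    intro τ
    rw [add_dotProduct, hwv, smul_dotProduct, smul_eq_mul, zero_add]
  have hne : ∀ τ : ℝ, w + τ • v ≠ 0 := by
    intro τ h
    have h1 := hline τ
    rw [h, zero_dotProduct] at h1
    have h2 : τ = 0 := by
      rcases mul_eq_zero.1 h1.symm with h | h
      · exact h
      · exact absurd h hq.ne'
    rw [h2, zero_smul, add_zero] at h
    exact hw0 h
  have hlow : ∀ z, (D.a x *ᵥ z) ⬝ᵥ v = z ⬝ᵥ D.a x *ᵥ v := by
    intro z
    rw [dotProduct_comm, dotProduct_mulVec_comm (hD.isSymm hx)]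
  -- half the derivative of `F²` along `τ ↦ w + τ v`
  have hder : ∀ τ : ℝ, HasDerivAt (fun τ : ℝ => D.coefQ x (w + τ • v) * (τ * q))
      (v ⬝ᵥ fundamentalTensor D.F x (w + τ • v) *ᵥ v) τ := by
    intro τ
    have hα := (hD.alpha_pos hx (hne τ)).ne'
    have h1 := hD.hasFDerivAt_coefQ (X := fun _ => x) (Y := fun w => w) hx (hne τ)
      (hasFDerivAt_quadratic (hD.isSymm hx) (w + τ • v)) (hasFDerivAt_dotProduct (D.b x) _)
      (hasFDerivAt_dotProduct (D.c x) _)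
    have h2 : HasDerivAt (fun τ : ℝ => w + τ • v) v τ := by
      simpa using ((hasDerivAt_id τ).smul_const v).const_add w
    have h3 := (h1.comp_hasDerivAt τ h2).mul ((hasDerivAt_id τ).mul_const q)
    refine h3.congr_deriv ?_
    have hl : D.unitForm x (w + τ • v) ⬝ᵥ v = τ * q / D.alpha x (w + τ • v) := by
      rw [eq_div_iff hα, mul_comm, ← smul_eq_mul, ← smul_dotProduct,
        ← hD.mulVec_eq hx (hne τ), hlow, hline]
    rw [hD.fundamentalTensor_mulVec hx (hne τ), hbv, hcv]
    simp only [dotProduct_add, dotProduct_smul, smul_eq_mul, dotProduct_comm v (D.b x),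
      dotProduct_comm v (D.c x), dotProduct_comm v (D.unitForm x _), hbv, hcv, hl, ← hqdef]
    simp [hlow, hline, hbv, hcv]
    field_simp
    ring
  have hpos : ∀ τ : ℝ, 0 < v ⬝ᵥ fundamentalTensor D.F x (w + τ • v) *ᵥ v := fun τ => by
    simpa using (hD.finsler.posDef x hx _ (hne τ)).dotProduct_mulVec_pos hv
  have hmono : StrictMono fun τ : ℝ => D.coefQ x (w + τ • v) * (τ * q) :=
    strictMono_of_hasDerivAt_pos hder hpos
  -- where `Π = 0` that derivative vanishes, as it does at `τ = 0`
  intro hPi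
  have hcoef : D.coefQ x (w + r • v) = 0 := by rw [← hyw, coefQ, hPi, mul_zero]
  have hr0 : r = 0 := hmono.injective (by simp [hcoef])
  -- now `y` is orthogonal to `v`, and `g(v, v) = Ψ Π a(v, v)`
  have h := hpos r
  have hl : D.unitForm x (w + r • v) ⬝ᵥ v = 0 := by
    have : D.alpha x (w + r • v) * (D.unitForm x (w + r • v) ⬝ᵥ v) = 0 := by
      rw [← smul_eq_mul, ← smul_dotProduct, ← hD.mulVec_eq hx (hne r), hlow, hline, hr0, zero_mul]
    exact (mul_eq_zero.1 this).resolve_left (hD.alpha_pos hx (hne r)).ne'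
  rw [hD.fundamentalTensor_mulVec hx (hne r), hbv, hcv, hl, hcoef] at h
  simp at h

theorem exists_annihilated (hn : 2 < n) (u w : Coord n) :
    ∃ v : Coord n, v ≠ 0 ∧ u ⬝ᵥ v = 0 ∧ w ⬝ᵥ v = 0 := by
  have h : LinearMap.ker (Matrix.mulVecLin (Matrix.of ![u, w])) ≠ ⊥ :=
    LinearMap.ker_ne_bot_of_finrank_lt (by simpa using hn)
  obtain ⟨v, hv, hv0⟩ := Submodule.exists_mem_ne_zero_of_ne_bot h
  have hv' : Matrix.of ![u, w] *ᵥ v = 0 := hv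
  exact ⟨v, hv0, congrFun hv' 0, congrFun hv' 1⟩

theorem IsABGMetric.PiFun_ne_zero (hD : D.IsABGMetric U b₀ g₀) (hn : 2 < n) {x y : Coord n}
    (hx : x ∈ U) (hy : y ≠ 0) : D.PiFun x y ≠ 0 := by
  obtain ⟨v, hv, hb, hc⟩ := exists_annihilated hn (D.b x) (D.c x)
  exact hD.PiFun_ne_zero_of_annihilated hx hy hv hb hc

/-- If `Γ` vanished, then so would the determinant of the linear map which the fundamental tensor
induces on the span of `b`, `γ` and `∂α/∂y`, contradicting positive definiteness. -/
theorem IsABGMetric.GammaFun_ne_zero (hD : D.IsABGMetric U b₀ g₀) {x y : Coord n}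
    (hx : x ∈ U) (hy : y ≠ 0) (hPi : D.PiFun x y ≠ 0) : D.GammaFun x y ≠ 0 := by
  intro hΓ
  have hP := (hD.P_pos hx hy).ne'
  have hdet : ((D.P x y * D.PiFun x y) • (1 : Matrix (Fin 3) (Fin 3) ℝ)
      + !![D.rho0 x y, D.rho3 x y, D.rho1 x y; D.rho3 x y, D.rho0Bar x y, D.rho1Bar x y;
          D.rho1 x y, D.rho1Bar x y, -(D.s x y * D.rho1 x y + D.t x y * D.rho1Bar x y)]
        * !![D.bSq x, D.theta x, D.s x y; D.theta x, D.gSq x, D.t x y;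
          D.s x y, D.t x y, 1]).det = 0 := by
    rw [det_induced_map (p₁₁ := D.Pss x y) (p₁₂ := D.Pst x y) (p₂₂ := D.Ptt x y) (J := D.J x y)
      (bb := D.bb x y) (gg := D.gg x y) (bg := D.bg x y) (Γ := D.GammaFun x y)
      (r₀ := D.rho0 x y) (q₀ := D.rho0Bar x y) (r₃ := D.rho3 x y) (r₁ := D.rho1 x y)
      (q₁ := D.rho1Bar x y) hPi rfl (div_mul_cancel₀ _ hPi) rfl rfl rfl rfl rfl rfl rfl rfl rfl,
      hΓ, mul_zero]
  obtain ⟨v, hv, hv0⟩ := Matrix.exists_mulVec_eq_zero_iff.2 hdet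
  obtain ⟨g1, g2, g3, g4, g5, g6, g7, g8, g9⟩ := hD.gram hx hy
  -- a kernel vector of the induced map gives a kernel vector `u` of `g`
  set u : Coord n := v 0 • D.bUp x + v 1 • D.cUp x + v 2 • ((D.a x)⁻¹ *ᵥ D.unitForm x y) with hu
  have hau : D.a x *ᵥ u = v 0 • D.b x + v 1 • D.c x + v 2 • D.unitForm x y := by
    simp only [hu, Matrix.mulVec_add, Matrix.mulVec_smul, hD.mulVec_inv hx]
    rw [show D.bUp x = (D.a x)⁻¹ *ᵥ D.b x from rfl, show D.cUp x = (D.a x)⁻¹ *ᵥ D.c x from rfl,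
      hD.mulVec_inv hx, hD.mulVec_inv hx]
  have hbu : D.b x ⬝ᵥ u = D.bSq x * v 0 + D.theta x * v 1 + D.s x y * v 2 := by
    simp only [hu, dotProduct_add, dotProduct_smul, smul_eq_mul, g1, g2, g7]
    ring
  have hcu : D.c x ⬝ᵥ u = D.theta x * v 0 + D.gSq x * v 1 + D.t x y * v 2 := by
    simp only [hu, dotProduct_add, dotProduct_smul, smul_eq_mul, g3, g4, g8]
    ring
  have hlu : D.unitForm x y ⬝ᵥ u = D.s x y * v 0 + D.t x y * v 1 + v 2 := by
    simp only [hu, dotProduct_add, dotProduct_smul, smul_eq_mul, g5, g6, g9]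
    ring
  have e0 := congrFun hv0 0
  have e1 := congrFun hv0 1
  have e2 := congrFun hv0 2
  simp [Matrix.mulVec, dotProduct, Fin.sum_univ_three] at e0 e1 e2
  have hgu : fundamentalTensor D.F x y *ᵥ u = 0 := by
    rw [hD.fundamentalTensor_mulVec hx hy, hau, hbu, hcu, hlu]
    ext i
    simp only [Pi.add_apply, Pi.smul_apply, smul_eq_mul, Pi.zero_apply, coefQ]
    linear_combination e0 * D.b x i + e1 * D.c x i + e2 * D.unitForm x y i
  have hu0 : u = 0 := by
    by_contra h
    have := (hD.finsler.posDef x hx y hy).dotProduct_mulVec_pos h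
    rw [hgu, dotProduct_zero] at this
    exact this.false
  rw [hu0, dotProduct_zero] at hbu hcu hlu
  -- with `u = 0` the kernel equations reduce to `Ψ Π v = 0`
  have hPP : D.P x y * D.PiFun x y ≠ 0 := mul_ne_zero hP hPi
  have z0 : D.P x y * D.PiFun x y * v 0 = 0 := by
    linear_combination e0 + D.rho0 x y * hbu + D.rho3 x y * hcu + D.rho1 x y * hlu
  have z1 : D.P x y * D.PiFun x y * v 1 = 0 := by
    linear_combination e1 + D.rho3 x y * hbu + D.rho0Bar x y * hcu + D.rho1Bar x y * hlu
  have z2 : D.P x y * D.PiFun x y * v 2 = 0 := by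
    linear_combination e2 + D.rho1 x y * hbu + D.rho1Bar x y * hcu
      - (D.s x y * D.rho1 x y + D.t x y * D.rho1Bar x y) * hlu
  apply hv
  ext i
  fin_cases i
  · exact (mul_eq_zero.1 z0).resolve_left hPP
  · exact (mul_eq_zero.1 z1).resolve_left hPP
  · exact (mul_eq_zero.1 z2).resolve_left hPP

/-! ### The spray formula -/

/-- The covector `a_ij H^j`, where `H` are the spray coefficients of `α`. -/
noncomputable def sprayForm (D : ABGData n) (x y : Coord n) (l : Fin n) : ℝ :=
  (1 / 4) * (2 * fderiv ℝ (fun z => (D.a z *ᵥ y) l) x y - pd l (fun z => D.quad z y) x)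

theorem IsABGMetric.eventually_isSymm (hD : D.IsABGMetric U b₀ g₀) (hU : IsOpen U)
    {x : Coord n} (hx : x ∈ U) : ∀ᶠ z in nhds x, (D.a z).IsSymm :=
  Filter.eventually_of_mem (hU.mem_nhds hx) fun _ hz => hD.isSymm hz

theorem IsABGMetric.sprayCoeff_alpha (hD : D.IsABGMetric U b₀ g₀) (hU : IsOpen U)
    {x : Coord n} (hx : x ∈ U) (y : Coord n) :
    sprayCoeff D.alpha x y = (D.a x)⁻¹ *ᵥ D.sprayForm x y := by
  have hev : (fun z => fundamentalTensor D.alpha z y) =ᶠ[nhds x] D.a :=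
    Filter.eventuallyEq_of_mem (hU.mem_nhds hx) fun _ hz => hD.fundamentalTensor_alpha hz y
  rw [sprayCoeff_eq_mulVec, hD.fundamentalTensor_alpha hx]
  · congr 1
    ext l
    have h1 : (fun z => (fundamentalTensor D.alpha z y *ᵥ y) l) =ᶠ[nhds x]
        fun z => (D.a z *ᵥ y) l := hev.mono fun z hz => by simp only [hz]
    have h2 : (fun z => y ⬝ᵥ fundamentalTensor D.alpha z y *ᵥ y) =ᶠ[nhds x]
        fun z => D.quad z y := hev.mono fun z hz => by simp only [hz, quad]
    rw [h1.fderiv_eq, pd_congr h2, sprayForm]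
  · intro i j
    exact (hD.differentiableAt_a hU hx i j).congr_of_eventuallyEq
      (hev.mono fun z hz => by simp only [hz])
  · filter_upwards [hev, hD.eventually_isSymm hU hx] with z hz hs
    rw [hz]; exact hs

/-- Euler's identity for the quadratic form `α²`. -/
theorem IsABGMetric.dotProduct_sprayForm (hD : D.IsABGMetric U b₀ g₀) (hU : IsOpen U)
    {x : Coord n} (hx : x ∈ U) (y : Coord n) :
    y ⬝ᵥ D.sprayForm x y = (1 / 4) * fderiv ℝ (fun z => D.quad z y) x y := by
  have h1 : HasFDerivAt (fun z => D.quad z y) (∑ l, y l • fderiv ℝ (fun z => (D.a z *ᵥ y) l) x) x :=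
    HasFDerivAt.fun_sum (u := Finset.univ) fun l _ =>
      (hD.differentiableAt_mulVec hU hx y l).hasFDerivAt.const_mul (y l)
  have h2 : fderiv ℝ (fun z => D.quad z y) x y
      = ∑ l, y l * fderiv ℝ (fun z => (D.a z *ᵥ y) l) x y := by
    rw [h1.fderiv]; simp
  have h3 := sum_mul_pd (fun z => D.quad z y) x y
  have h4 : y ⬝ᵥ D.sprayForm x y
      = (1 / 4) * (2 * ∑ l, y l * fderiv ℝ (fun z => (D.a z *ᵥ y) l) x y
        - ∑ l, pd l (fun z => D.quad z y) x * y l) := by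
    simp only [dotProduct, sprayForm, Finset.mul_sum, ← Finset.sum_sub_distrib]
    refine Finset.sum_congr rfl fun l _ => ?_
    ring
  rw [h4, ← h2, h3]
  ring

/-- Expansion of the spray of `F` by the product rule applied to `½ ∂(F²)/∂y^l`. -/
theorem IsABGMetric.sprayCoeff_F (hD : D.IsABGMetric U b₀ g₀) (hU : IsOpen U)
    {x y : Coord n} (hx : x ∈ U) (hy : y ≠ 0) :
    sprayCoeff D.F x y = (fundamentalTensor D.F x y)⁻¹ *ᵥ
      (D.coefQ x y • D.sprayForm x y + D.coefB x y • sLow0 D.a D.b x y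
        + D.coefC x y • sLow0 D.a D.c x y
        + (1 / 2 * fderiv ℝ (fun z => D.coefQ z y) x y) • (D.a x *ᵥ y)
        + (1 / 2 * fderiv ℝ (fun z => D.coefB z y) x y) • D.b x
        + (1 / 2 * fderiv ℝ (fun z => D.coefC z y) x y) • D.c x) := by
  have hQ := (hD.differentiableAt_quad hU hx y).hasFDerivAt
  have hβ := (hD.differentiableAt_beta hU hx y).hasFDerivAt
  have hγ := (hD.differentiableAt_gamma hU hx y).hasFDerivAt
  have hsq := hD.hasFDerivAt_sq_F (X := fun z => z) (Y := fun _ => y) hx hy hQ hβ hγ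
  have hq := (hD.hasFDerivAt_coefQ (X := fun z => z) (Y := fun _ => y) hx hy hQ hβ
    hγ).differentiableAt
  have hb := (hD.hasFDerivAt_coefB (X := fun z => z) (Y := fun _ => y) hx hy hQ hβ
    hγ).differentiableAt
  have hc := (hD.hasFDerivAt_coefC (X := fun z => z) (Y := fun _ => y) hx hy hQ hβ
    hγ).differentiableAt
  have hUx := hU.mem_nhds hx
  rw [sprayCoeff_eq_mulVec (fun i j => hD.differentiableAt_fundamentalTensor hU hx hy i j)
    (Filter.eventually_of_mem hUx fun z hz => (hD.finsler.posDef z hz y hy).isHermitian)]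
  congr 1
  ext l
  have h1 : (fun z => (fundamentalTensor D.F z y *ᵥ y) l) =ᶠ[nhds x] fun z =>
      D.coefQ z y * (D.a z *ᵥ y) l + D.coefB z y * D.b z l + D.coefC z y * D.c z l :=
    Filter.eventuallyEq_of_mem hUx fun z hz => by
      simp [hD.fundamentalTensor_mulVec_self hz hy]
  have h2 : (fun z => y ⬝ᵥ fundamentalTensor D.F z y *ᵥ y) =ᶠ[nhds x] fun z => D.F z y ^ 2 :=
    Filter.eventuallyEq_of_mem hUx fun z hz => hD.dotProduct_fundamentalTensor_mulVec_self hz hy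
  have h3 := ((hq.hasFDerivAt.mul (hD.differentiableAt_mulVec hU hx y l).hasFDerivAt).add
    (hb.hasFDerivAt.mul (hD.differentiableAt_b hU hx l).hasFDerivAt)).add
    (hc.hasFDerivAt.mul (hD.differentiableAt_c hU hx l).hasFDerivAt)
  have h4 : pd l (fun z => D.F z y ^ 2) x = D.coefQ x y * pd l (fun z => D.quad z y) x
      + 2 * D.coefB x y * pd l (fun z => D.b z ⬝ᵥ y) x
      + 2 * D.coefC x y * pd l (fun z => D.c z ⬝ᵥ y) x := by
    rw [pd, hsq.fderiv]
    rfl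
  have hsymm := hD.eventually_isSymm hU hx
  have h5 := sLow0_eq (hD.differentiableAt_b hU hx) hsymm y l
  have h6 := sLow0_eq (hD.differentiableAt_c hU hx) hsymm y l
  rw [h1.fderiv_eq, pd_congr h2, h4]
  erw [h3.fderiv]
  simp only [add_apply, smul_apply, Pi.add_apply, Pi.smul_apply,
    smul_eq_mul, h5, h6, sprayForm]
  ring

/-- The spray formula, as an identity of vectors. -/
theorem IsABGMetric.sprayCoeff_F_eq (hD : D.IsABGMetric U b₀ g₀) (hU : IsOpen U)
    {x y : Coord n} (hx : x ∈ U) (hy : y ≠ 0) (hPi : D.PiFun x y ≠ 0) :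
    sprayCoeff D.F x y = sprayCoeff D.alpha x y
      + (D.alpha x y / D.PiFun x y) •
        (D.Ps x y • sUp0 D.a D.b x y + D.Pt x y • sUp0 D.a D.c x y)
      + (1 / (2 * D.GammaFun x y)) • (D.Gamma1 x y • D.bUp x + D.Gamma2 x y • D.cUp x
        + (1 / D.P x y * D.Gamma3 x y) • ((D.a x)⁻¹ *ᵥ D.unitForm x y)) := by
  have hΓ := hD.GammaFun_ne_zero hx hy hPi
  have hα := (hD.alpha_pos hx hy).ne'
  have hP := (hD.P_pos hx hy).ne'
  have hdet : IsUnit (fundamentalTensor D.F x y).det :=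
    (hD.finsler.posDef x hx y hy).isUnit.map Matrix.detMonoidHom
  have hsymm := hD.eventually_isSymm hU hx
  have hQ := (hD.differentiableAt_quad hU hx y).hasFDerivAt
  have hβ := (hD.differentiableAt_beta hU hx y).hasFDerivAt
  have hγ := (hD.differentiableAt_gamma hU hx y).hasFDerivAt
  have dq := congrArg (fun φ => φ y)
    (hD.hasFDerivAt_coefQ (X := fun z => z) (Y := fun _ => y) hx hy hQ hβ hγ).fderiv
  have db := congrArg (fun φ => φ y)
    (hD.hasFDerivAt_coefB (X := fun z => z) (Y := fun _ => y) hx hy hQ hβ hγ).fderiv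
  have dc := congrArg (fun φ => φ y)
    (hD.hasFDerivAt_coefC (X := fun z => z) (Y := fun _ => y) hx hy hQ hβ hγ).fderiv
  simp only [add_apply, smul_apply, smul_eq_mul] at dq db dc
  set H := sprayCoeff D.alpha x y with hH
  have hHeq : H = (D.a x)⁻¹ *ᵥ D.sprayForm x y := hD.sprayCoeff_alpha hU hx y
  have haH : D.a x *ᵥ H = D.sprayForm x y := by rw [hHeq, hD.mulVec_inv hx]
  have hδQ : fderiv ℝ (fun z => D.quad z y) x y
      = 4 * (D.alpha x y * (D.unitForm x y ⬝ᵥ H)) := by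
    rw [← smul_eq_mul (D.alpha x y), ← smul_dotProduct, ← hD.mulVec_eq hx hy, dotProduct_comm,
      dotProduct_mulVec_comm (hD.isSymm hx), haH, hD.dotProduct_sprayForm hU hx]
    ring
  have hδβ : fderiv ℝ (fun z => D.beta z y) x y = r00 D.a D.b x y + 2 * (D.b x ⬝ᵥ H) := by
    rw [hHeq, r00_eq (hD.differentiableAt_b hU hx) (hD.differentiableAt_a hU hx) hsymm y]
    exact (sub_add_cancel _ _).symm
  have hδγ : fderiv ℝ (fun z => D.gamma z y) x y = r00 D.a D.c x y + 2 * (D.c x ⬝ᵥ H) := by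
    rw [hHeq, r00_eq (hD.differentiableAt_c hU hx) (hD.differentiableAt_a hU hx) hsymm y]
    exact (sub_add_cancel _ _).symm
  rw [hδQ, hδβ, hδγ] at dq db dc
  obtain ⟨g1, g2, g3, g4, g5, g6, g7, g8, g9⟩ := hD.gram hx hy
  have s1 : D.b x ⬝ᵥ sUp0 D.a D.b x y = s0 D.a D.b x y := (s0_eq (hD.isSymm_inv hx) _ _).symm
  have s2 : D.c x ⬝ᵥ sUp0 D.a D.c x y = s0 D.a D.c x y := (s0_eq (hD.isSymm_inv hx) _ _).symm
  have s3 : D.b x ⬝ᵥ sUp0 D.a D.c x y = sMixed0 D.a D.c D.b x y := (sMixed0_eq _ _ _).symm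
  have s4 : D.c x ⬝ᵥ sUp0 D.a D.b x y = sMixed0 D.a D.b D.c x y := (sMixed0_eq _ _ _).symm
  have s5 : ∀ w : Coord n → Coord n, D.unitForm x y ⬝ᵥ sUp0 D.a w x y = 0 := fun w => by
    rw [show sUp0 D.a w x y = (D.a x)⁻¹ *ᵥ sLow0 D.a w x y from rfl,
      hD.unitForm_dotProduct_inv hx, dotProduct_comm, dotProduct_sLow0, zero_div]
  have s6 : ∀ w : Coord n → Coord n, D.a x *ᵥ sUp0 D.a w x y = sLow0 D.a w x y := fun w =>
    hD.mulVec_inv hx _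
  have s7 : D.a x *ᵥ D.bUp x = D.b x := hD.mulVec_inv hx _
  have s8 : D.a x *ᵥ D.cUp x = D.c x := hD.mulVec_inv hx _
  obtain ⟨e1, e2, e3⟩ := spray_coefficients_solve (s := D.s x y) (t := D.t x y) (B := D.bSq x)
    (G := D.gSq x) (T := D.theta x) (p₁₁ := D.Pss x y) (p₁₂ := D.Pst x y) (p₂₂ := D.Ptt x y)
    (J := D.J x y) (bb := D.bb x y) (gg := D.gg x y) (bg := D.bg x y) (Γ := D.GammaFun x y)
    (r₀ := D.rho0 x y) (q₀ := D.rho0Bar x y) (r₃ := D.rho3 x y) (r₁ := D.rho1 x y)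
    (q₁ := D.rho1Bar x y) (R := D.Rb x y) (R' := D.Rc x y)
    (w₁ := D.Gamma1 x y) (w₂ := D.Gamma2 x y) (w₃ := 1 / D.P x y * D.Gamma3 x y)
    hP hPi rfl (div_mul_cancel₀ _ hPi) rfl rfl rfl rfl rfl rfl rfl rfl rfl rfl rfl
    (by rw [← mul_assoc, mul_one_div_cancel hP, one_mul]; rfl)
  rw [hD.sprayCoeff_F hU hx hy]
  -- it suffices to compare the images of both sides under `g`
  refine (Matrix.mulVec_injective_iff_isUnit.2
    ((Matrix.isUnit_iff_isUnit_det _).2 hdet)) ?_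
  rw [Matrix.mulVec_mulVec, Matrix.mul_nonsing_inv _ hdet, Matrix.one_mulVec,
    hD.fundamentalTensor_mulVec hx hy]
  have hκ : D.alpha x y / D.PiFun x y * D.PiFun x y = D.alpha x y := div_mul_cancel₀ _ hPi
  have hν : 1 / (2 * D.GammaFun x y) * D.GammaFun x y = 1 / 2 := by field_simp
  have hRb : D.Rb x y = r00 D.a D.b x y - 2 * (D.alpha x y / D.PiFun x y)
      * (D.Ps x y * s0 D.a D.b x y + D.Pt x y * sMixed0 D.a D.c D.b x y) := by
    rw [Rb]; ring
  have hRc : D.Rc x y = r00 D.a D.c x y - 2 * (D.alpha x y / D.PiFun x y)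
      * (D.Ps x y * sMixed0 D.a D.b D.c x y + D.Pt x y * s0 D.a D.c x y) := by
    rw [Rc]; ring
  rw [hRb, hRc] at e1 e2 e3
  have dq' : fderiv ℝ (fun z => D.coefQ z y) x y * D.alpha x y =
      -(D.s x y * D.rho1 x y + D.t x y * D.rho1Bar x y) * (2 * (D.unitForm x y ⬝ᵥ H))
        + D.rho1 x y * (r00 D.a D.b x y + 2 * (D.b x ⬝ᵥ H))
        + D.rho1Bar x y * (r00 D.a D.c x y + 2 * (D.c x ⬝ᵥ H)) := by
    rw [dq]; field_simp; ring
  have db' : fderiv ℝ (fun z => D.coefB z y) x y =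
      D.rho1 x y * (2 * (D.unitForm x y ⬝ᵥ H))
        + D.rho0 x y * (r00 D.a D.b x y + 2 * (D.b x ⬝ᵥ H))
        + D.rho3 x y * (r00 D.a D.c x y + 2 * (D.c x ⬝ᵥ H)) := by
    rw [db]; field_simp; ring
  have dc' : fderiv ℝ (fun z => D.coefC z y) x y =
      D.rho1Bar x y * (2 * (D.unitForm x y ⬝ᵥ H))
        + D.rho3 x y * (r00 D.a D.b x y + 2 * (D.b x ⬝ᵥ H))
        + D.rho0Bar x y * (r00 D.a D.c x y + 2 * (D.c x ⬝ᵥ H)) := by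
    rw [dc]; field_simp; ring
  clear dq db dc
  simp only [Matrix.mulVec_add, Matrix.mulVec_smul, dotProduct_add, dotProduct_smul, smul_eq_mul,
    haH, s6, s7, s8, hD.mulVec_inv hx, g1, g2, g3, g4, g5, g6, g7, g8, g9, s1, s2, s3, s4, s5,
    hD.mulVec_eq hx hy]
  generalize D.alpha x y / D.PiFun x y = κ at *
  generalize 1 / (2 * D.GammaFun x y) = ν at *
  generalize 1 / D.P x y * D.Gamma3 x y = w₃ at *
  ext l
  simp only [Pi.add_apply, Pi.smul_apply, smul_eq_mul, coefQ, coefB, coefC] at *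
  set R := r00 D.a D.b x y - 2 * κ
      * (D.Ps x y * s0 D.a D.b x y + D.Pt x y * sMixed0 D.a D.c D.b x y) with hR
  set R' := r00 D.a D.c x y - 2 * κ
      * (D.Ps x y * sMixed0 D.a D.b D.c x y + D.Pt x y * s0 D.a D.c x y) with hR'
  linear_combination (1 / 2 * D.b x l) * db' + (1 / 2 * D.c x l) * dc'
    + (1 / 2 * D.unitForm x y l) * dq'
    - ν * (D.b x l * e1 + D.c x l * e2 + D.unitForm x y l * e3)
    - hν * ((D.rho0 x y * R + D.rho3 x y * R') * D.b x l
      + (D.rho3 x y * R + D.rho0Bar x y * R') * D.c x l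
      + (D.rho1 x y * R + D.rho1Bar x y * R') * D.unitForm x y l)
    - hκ * (D.P x y * (D.Ps x y * sLow0 D.a D.b x y l + D.Pt x y * sLow0 D.a D.c x y l))

end ABGData
end Finsler

theorem mainTheorem2 {n : ℕ} (U : Set (Finsler.Coord n)) (hU : IsOpen U)
    (D : Finsler.ABGData n) (b₀ g₀ : ℝ) (hD : D.IsABGMetric U b₀ g₀)
    (x : Finsler.Coord n) (hx : x ∈ U) (y : Finsler.Coord n) (hy : y ≠ 0)
    (hPi : n ≤ 2 → D.PiFun x y ≠ 0) :
    D.PiFun x y ≠ 0 ∧ D.GammaFun x y ≠ 0 ∧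
    ∀ i : Fin n,
      Finsler.sprayCoeff D.F x y i =
        Finsler.sprayCoeff D.alpha x y i
        + D.alpha x y / D.PiFun x y *
          (D.Ps x y * Finsler.sUp0 D.a D.b x y i + D.Pt x y * Finsler.sUp0 D.a D.c x y i)
        + 1 / (2 * D.GammaFun x y) *
          (D.Gamma1 x y * D.bUp x i + D.Gamma2 x y * D.cUp x i
            + 1 / D.P x y * D.Gamma3 x y * D.alphaUp x y i) := by
  have hne : D.PiFun x y ≠ 0 := by
    rcases le_or_gt n 2 with hn | hn
    · exact hPi hn
    · exact hD.PiFun_ne_zero hn hx hy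
  refine ⟨hne, hD.GammaFun_ne_zero hx hy hne, fun i => ?_⟩
  have hl : D.alphaUp x y = (D.a x)⁻¹ *ᵥ D.unitForm x y := by
    rw [show D.unitForm x y = fun j => Finsler.pd j (D.alpha x) y from
      funext fun j => (hD.pd_alpha hx hy j).symm]
    rfl
  rw [hl]
  exact congrFun (hD.sprayCoeff_F_eq hU hx hy hne) i
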